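/- Fix an optimal plain decompressor and an optimal prefix-free decompressor (partial computable functions from binary strings to natural numbers), with the resulting plain Kolmogorov complexity $C$ and prefix complexity $K$. Fix also an a priori probability $m$ on $\mathbb N$: a convergent lower semicomputable series of non-negative reals $m(k)$, maximal up to a multiplicative constant among such series. For $t\in\mathbb Z$ let $$B(t)=\max\{N\in\mathbb N: C(N)\le t\},\qquad BP(t)=\max\{N\in\mathbb N: K(N)\le t\},\qquad BP'(t)=\min\Big\{N\in\mathbb N:\sum_{k>N}m(k)<2^{-t}\Big\},$$ where $\max\varnothing=0$. A sequence of reals is lower (respectively upper) semicomputable if it is the pointwise limit $\lim_k q(n,k)$ of a total computable rational-valued function $q$ that is non-decreasing (respectively non-increasing) in $k$. Let $(a_n)_{n\in\mathbb N}$ be an upper semicomputable sequence of integers. Then the following eight conditions are equivalent (in 1–6, "for some constant $c\in\mathbb N$ and all $n\in\mathbb N$"): 1. $BP'(n)\le BP(n+a_n+c)$; 2. $B(n)\le BP'(n+a_n+c)$; 3. $B(n)\le BP(n+a_n+c)$; 4. $BP'(n-a_n)\le BP(n+c)$; 5. $B(n-a_n)\le BP'(n+c)$; 6. $B(n-a_n)\le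 BP(n+c)$; 7. $\sum_n 2^{-a_n}<+\infty$; 8. there is a constant $c\in\mathbb N$ such that $a_n\ge K(n)-c$ for all $n\in\mathbb N$. -/

import Mathlib

open Filter Topology

namespace BusyBeaver

/-- A total computable rational-valued function of two natural arguments: its values are
computed as fractions `(u - v) / (w + 1)` with natural `u`, `v`, `w`. -/
def ComputableRat (q : ℕ → ℕ → ℚ) : Prop :=
  ∃ u v w : ℕ → ℕ → ℕ, Computable₂ u ∧ Computable₂ v ∧ Computable₂ w ∧
    ∀ n k, q n k = ((u n k : ℚ) - (v n k : ℚ)) / ((w n k : ℚ) + 1)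

/-- A sequence of reals is lower semicomputable if it is the pointwise limit of a total
computable rational-valued function `q n k` that is non-decreasing in `k`. -/
def LowerSemicomputable (f : ℕ → ℝ) : Prop :=
  ∃ q : ℕ → ℕ → ℚ, ComputableRat q ∧ (∀ n, Monotone (q n)) ∧
    ∀ n, Tendsto (fun k => (q n k : ℝ)) atTop (𝓝 (f n))

/-- A sequence of reals is upper semicomputable if it is the pointwise limit of a total
computable rational-valued function `q n k` that is non-increasing in `k`. -/
def UpperSemicomputable (f : ℕ → ℝ) : Prop :=
  ∃ q : ℕ → ℕ → ℚ, ComputableRat q ∧ (∀ n, Antitone (q n)) ∧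
    ∀ n, Tendsto (fun k => (q n k : ℝ)) atTop (𝓝 (f n))

/-- Complexity of `x` with respect to the decompressor `D`: the minimal length of a binary
string `p` with `D p = x`, and `⊤` if there is none. -/
noncomputable def complexity (D : List Bool →. ℕ) (x : ℕ) : ℕ∞ :=
  ⨅ (p : List Bool) (_ : x ∈ D p), (p.length : ℕ∞)

/-- An optimal plain decompressor; `complexity D` is then plain Kolmogorov complexity. -/
def IsOptimalPlain (D : List Bool →. ℕ) : Prop :=
  Partrec D ∧ ∀ D' : List Bool →. ℕ, Partrec D' →
    ∃ c : ℕ, ∀ x, complexity D x ≤ complexity D' x + c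

/-- No string in the domain of `D` is a proper prefix of another string in the domain. -/
def PrefixFree (D : List Bool →. ℕ) : Prop :=
  ∀ p q : List Bool, (D p).Dom → (D q).Dom → p <+: q → p = q

/-- An optimal prefix-free decompressor; `complexity P` is then prefix Kolmogorov complexity. -/
def IsOptimalPrefix (P : List Bool →. ℕ) : Prop :=
  Partrec P ∧ PrefixFree P ∧ ∀ P' : List Bool →. ℕ, Partrec P' → PrefixFree P' →
    ∃ c : ℕ, ∀ x, complexity P x ≤ complexity P' x + c

/-- A priori probability: a lower semicomputable converging series of non-negative reals that
is maximal, up to a multiplicative constant, among all such series. -/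
def IsAPriori (m : ℕ → ℝ) : Prop :=
  ((∀ k, 0 ≤ m k) ∧ Summable m ∧ LowerSemicomputable m) ∧
    ∀ m' : ℕ → ℝ, (∀ k, 0 ≤ m' k) → Summable m' → LowerSemicomputable m' →
      ∃ C : ℝ, ∀ k, m' k ≤ C * m k

/-- The busy beaver function of a decompressor: the maximal number of complexity at most `t`.
The argument may be any integer; the maximum of the empty set is `0`. -/
noncomputable def busyBeaver (D : List Bool →. ℕ) (t : ℤ) : ℕ :=
  sSup {N : ℕ | ∃ k : ℕ, complexity D N = k ∧ (k : ℤ) ≤ t}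

/-- The modulus of convergence of the series `∑ m k`: the minimal `N` such that
`∑_{k > N} m k < 2 ^ (-t)`. -/
noncomputable def tailModulus (m : ℕ → ℝ) (t : ℤ) : ℕ :=
  sInf {N : ℕ | ∑' k : ℕ, m (N + 1 + k) < (2 : ℝ) ^ (-t)}

end BusyBeaver

open BusyBeaver

open BusyBeaver

/-! Conditions 7 and 8 are linked by Kraft's inequality (`kraft_of_prefixFree`) and its effective
converse (`exists_programs_of_requests`). Condition 8 yields the growth bounds because a prefix-free
program for n can be followed by a padded plain program: once n is decoded, the number of remaining
bits is known (`exists_busyBeaver_le_of_program`). The bound BP'(t) ≤ B(max(t,0)+d) extends this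
from B to BP', and BP(t) ≤ BP'(t+c) leads from 3 to 2 and from 6 to 5.

The substance is the return from 1, 2, 4, 5 to 7, through `ForcesSummable`. If ∑ 2^(e-b(e)) diverges
for an upper semicomputable b, finite pieces of arbitrarily large total are found effectively, with
computable upper approximations γ(e) in place of b(e). Such a piece defeats the assumed inequality
in either of two games.

B against BP' (`false_of_busyBeaver_le`): lay end to end, for each e, a block of 2^e intervals of
length 2^(-γ(e)), until ∑ m is covered. The interval containing ∑ m is named by e bits plus a
constant and locates ∑ m within 2^(-γ(e)), so B(e+const) exceeds BP'(γ(e)).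

BP' against BP (`false_of_tailModulus_le`): build a convergent series whose partial sums follow the
minimum of 1 and the quantities 2^(-e)·(number of programs of length at most γ(e) seen so far, plus
1). If the final minimum is attained at some e, mass 2^(-e) still appears after BP(γ(e)), and
maximality of m makes BP'(e+const) exceed BP(γ(e)). If it is 1, there are about 2^e programs of
length at most γ(e) for every e in the piece, against Kraft's inequality.

Conditions 4 and 5 are inverted before the games apply: e is paired with the least n such that n -
a_n ≥ e. -/

namespace BusyBeaver

/-! ### Closure properties of computable functions -/

section Computability

variable {α β γ σ : Type*} [Primcodable α] [Primcodable β] [Primcodable γ] [Primcodable σ]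

/-- `Computable`, as a structure: `fun_prop` then never unfolds it. -/
@[fun_prop]
structure IsComputable (f : α → σ) : Prop where
  computable : Computable f

theorem IsComputable.of_eq {f g : α → σ} (hf : IsComputable f) (h : ∀ a, f a = g a) :
    IsComputable g := ⟨hf.1.of_eq h⟩

theorem Computable₂.isComputable {h : β → γ → σ} (hh : Computable₂ h) {f : α → β} {g : α → γ}
    (hf : IsComputable f) (hg : IsComputable g) : IsComputable fun a => h (f a) (g a) :=
  ⟨hh.comp hf.1 hg.1⟩

theorem Primrec₂.isComputable {h : β → γ → σ} (hh : Primrec₂ h) {f : α → β} {g : α → γ}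
    (hf : IsComputable f) (hg : IsComputable g) : IsComputable fun a => h (f a) (g a) :=
  ⟨hh.to_comp.comp hf.1 hg.1⟩

@[fun_prop]
theorem computable_id : IsComputable fun a : α => a := ⟨Computable.id⟩

@[fun_prop]
theorem computable_const (x : σ) : IsComputable fun _ : α => x := ⟨Computable.const x⟩

@[fun_prop]
theorem computable_comp {f : β → σ} {g : α → β} (hf : IsComputable f) (hg : IsComputable g) :
    IsComputable fun a => f (g a) := ⟨hf.1.comp hg.1⟩

@[fun_prop]
theorem computable_fst {g : α → β × σ} (hg : IsComputable g) : IsComputable fun a => (g a).1 :=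
  ⟨Computable.fst.comp hg.1⟩

@[fun_prop]
theorem computable_snd {g : α → β × σ} (hg : IsComputable g) : IsComputable fun a => (g a).2 :=
  ⟨Computable.snd.comp hg.1⟩

@[fun_prop]
theorem computable_pair {g : α → β} {h : α → σ} (hg : IsComputable g) (hh : IsComputable h) :
    IsComputable fun a => (g a, h a) := ⟨hg.1.pair hh.1⟩

@[fun_prop]
theorem computable_add {f g : α → ℕ} (hf : IsComputable f) (hg : IsComputable g) :
    IsComputable fun a => f a + g a := Primrec₂.isComputable Primrec.nat_add hf hg

@[fun_prop]
theorem computable_mul {f g : α → ℕ} (hf : IsComputable f) (hg : IsComputable g) :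
    IsComputable fun a => f a * g a := Primrec₂.isComputable Primrec.nat_mul hf hg

@[fun_prop]
theorem computable_sub {f g : α → ℕ} (hf : IsComputable f) (hg : IsComputable g) :
    IsComputable fun a => f a - g a := Primrec₂.isComputable Primrec.nat_sub hf hg

@[fun_prop]
theorem computable_div {f g : α → ℕ} (hf : IsComputable f) (hg : IsComputable g) :
    IsComputable fun a => f a / g a := Primrec₂.isComputable Primrec.nat_div hf hg

@[fun_prop]
theorem computable_pow {f g : α → ℕ} (hf : IsComputable f) (hg : IsComputable g) :
    IsComputable fun a => f a ^ g a :=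
  Primrec₂.isComputable (Primrec₂.unpaired'.1 Nat.Primrec.pow) hf hg

@[fun_prop]
theorem computable_unpair_fst {f : α → ℕ} (hf : IsComputable f) :
    IsComputable fun a => (Nat.unpair (f a)).1 :=
  ⟨Computable.fst.comp (Computable.unpair.comp hf.1)⟩

@[fun_prop]
theorem computable_unpair_snd {f : α → ℕ} (hf : IsComputable f) :
    IsComputable fun a => (Nat.unpair (f a)).2 :=
  ⟨Computable.snd.comp (Computable.unpair.comp hf.1)⟩

@[fun_prop]
theorem computable_decide_le {f g : α → ℕ} [∀ a, Decidable (f a ≤ g a)] (hf : IsComputable f)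
    (hg : IsComputable g) : IsComputable fun a => decide (f a ≤ g a) :=
  (Computable₂.isComputable Primrec.nat_le.decide.to_comp hf hg).of_eq fun _ => by congr

@[fun_prop]
theorem computable_decide_lt {f g : α → ℕ} [∀ a, Decidable (f a < g a)] (hf : IsComputable f)
    (hg : IsComputable g) : IsComputable fun a => decide (f a < g a) :=
  (Computable₂.isComputable Primrec.nat_lt.decide.to_comp hf hg).of_eq fun _ => by congr

@[fun_prop]
theorem computable_decide_eq [DecidableEq β] {f g : α → β} [∀ a, Decidable (f a = g a)]
    (hf : IsComputable f) (hg : IsComputable g) : IsComputable fun a => decide (f a = g a) :=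
  (Computable₂.isComputable (Primrec.eq (α := β)).decide.to_comp hf hg).of_eq fun _ => by congr

@[fun_prop]
theorem computable_bool_and {f g : α → Bool} (hf : IsComputable f) (hg : IsComputable g) :
    IsComputable fun a => f a && g a := Primrec₂.isComputable Primrec.and hf hg

@[fun_prop]
theorem computable_decide_and {p q : α → Prop} [DecidablePred p] [DecidablePred q]
    [∀ a, Decidable (p a ∧ q a)] (hf : IsComputable fun a => decide (p a))
    (hg : IsComputable fun a => decide (q a)) : IsComputable fun a => decide (p a ∧ q a) :=
  (computable_bool_and hf hg).of_eq fun a => by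
    by_cases hp : p a <;> by_cases hq : q a <;> simp [hp, hq]

@[fun_prop]
theorem computable_ite {p : α → Prop} [DecidablePred p] {f g : α → σ}
    (hp : IsComputable fun a => decide (p a)) (hf : IsComputable f) (hg : IsComputable g) :
    IsComputable fun a => if p a then f a else g a :=
  (IsComputable.mk (Computable.cond hp.1 hf.1 hg.1)).of_eq fun a => by by_cases h : p a <;> simp [h]

@[fun_prop]
theorem computable_some {f : α → σ} (hf : IsComputable f) : IsComputable fun a => some (f a) :=
  ⟨Computable.option_some.comp hf.1⟩

@[fun_prop]
theorem computable_isSome {f : α → Option σ} (hf : IsComputable f) :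
    IsComputable fun a => (f a).isSome :=
  ⟨Primrec.option_isSome.to_comp.comp hf.1⟩

@[fun_prop]
theorem computable_getD {f : α → Option σ} {g : α → σ} (hf : IsComputable f)
    (hg : IsComputable g) : IsComputable fun a => (f a).getD (g a) := ⟨hf.1.option_getD hg.1⟩

@[fun_prop]
theorem computable_encode {f : α → σ} (hf : IsComputable f) :
    IsComputable fun a => Encodable.encode (f a) := ⟨Computable.encode.comp hf.1⟩

@[fun_prop]
theorem computable_decode {f : α → ℕ} (hf : IsComputable f) :
    IsComputable fun a => (Encodable.decode (f a) : Option σ) := ⟨Computable.decode.comp hf.1⟩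

@[fun_prop]
theorem computable_length {f : α → List σ} (hf : IsComputable f) :
    IsComputable fun a => (f a).length := ⟨Computable.list_length.comp hf.1⟩

@[fun_prop]
theorem computable_take {n : α → ℕ} {f : α → List σ} (hn : IsComputable n) (hf : IsComputable f) :
    IsComputable fun a => (f a).take (n a) := Primrec₂.isComputable Primrec.list_take hn hf

@[fun_prop]
theorem computable_drop {n : α → ℕ} {f : α → List σ} (hn : IsComputable n) (hf : IsComputable f) :
    IsComputable fun a => (f a).drop (n a) := Primrec₂.isComputable Primrec.list_drop hn hf

@[fun_prop]
theorem computable_idxOf_true {f : α → List Bool} (hf : IsComputable f) :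
    IsComputable fun a => (f a).idxOf true :=
  ⟨Primrec.list_idxOf.to_comp.comp (Computable.const true) hf.1⟩

@[fun_prop]
theorem computable_nat_rec {f : α → ℕ} {g : α → σ} {h : α → ℕ → σ → σ} (hf : IsComputable f)
    (hg : IsComputable g) (hh : IsComputable fun p : α × ℕ × σ => h p.1 p.2.1 p.2.2) :
    IsComputable fun a => Nat.rec (motive := fun _ => σ) (g a) (h a) (f a) :=
  ⟨Computable.nat_rec hf.1 hg.1 (h := fun a p => h a p.1 p.2) hh.1⟩

theorem exists_computable_least {p : α → ℕ → Prop} [∀ a, DecidablePred (p a)]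
    (hp : IsComputable fun x : α × ℕ => decide (p x.1 x.2)) (h : ∀ a, ∃ n, p a n) :
    ∃ F : α → ℕ, IsComputable F ∧ ∀ a, p a (F a) ∧ ∀ n, p a n → F a ≤ n := by
  have hr : Partrec fun a => Nat.rfind fun n => (Part.some (decide (p a n)) : Part Bool) :=
    Partrec.rfind (p := fun a n => Part.some (decide (p a n))) hp.1.partrec.to₂
  refine ⟨fun a => Nat.find (h a), ⟨hr.of_eq_tot fun a => ?_⟩, fun a =>
    ⟨Nat.find_spec (h a), fun n hn => Nat.find_min' (h a) hn⟩⟩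
  refine Nat.mem_rfind.2 ⟨?_, fun {k} hk => ?_⟩
  · exact Part.mem_some_iff.2 (decide_eq_true (Nat.find_spec (h a))).symm
  · exact Part.mem_some_iff.2 (decide_eq_false (Nat.find_min (h a) hk)).symm

/-- The binary value of a string, the first bit being the most significant. -/
def binaryValue (w : List Bool) : ℕ := w.foldl (fun s b => 2 * s + b.toNat) 0

@[fun_prop]
theorem computable_binaryValue {f : α → List Bool} (hf : IsComputable f) :
    IsComputable fun a => binaryValue (f a) := by
  have : Primrec binaryValue := by
    refine Primrec.list_foldl (h := fun _ (p : ℕ × Bool) => 2 * p.1 + p.2.toNat) Primrec.id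
      (Primrec.const 0) ?_
    exact Primrec.nat_add.comp
      (Primrec.nat_mul.comp (Primrec.const 2) (Primrec.fst.comp Primrec.snd))
      ((Primrec.dom_bool Bool.toNat).comp (Primrec.snd.comp Primrec.snd))
  exact ⟨this.to_comp.comp hf.1⟩

end Computability

/-! ### Strings as binary numerals -/

section Words

theorem foldl_binary_eq (w : List Bool) (s : ℕ) :
    w.foldl (fun s b => 2 * s + b.toNat) s = s * 2 ^ w.length + binaryValue w := by
  induction w generalizing s with
  | nil => simp [binaryValue]
  | cons b w ih =>
    simp only [binaryValue, List.foldl_cons, List.length_cons]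
    rw [ih, ih (2 * 0 + b.toNat)]
    ring

theorem binaryValue_append (v w : List Bool) :
    binaryValue (v ++ w) = binaryValue v * 2 ^ w.length + binaryValue w := by
  rw [binaryValue, List.foldl_append, foldl_binary_eq]; rfl

theorem binaryValue_lt (w : List Bool) : binaryValue w < 2 ^ w.length := by
  induction w using List.reverseRecOn with
  | nil => simp [binaryValue]
  | append_singleton w b ih =>
    rw [binaryValue_append]
    have : binaryValue [b] ≤ 1 := by cases b <;> simp [binaryValue]
    simp only [List.length_append, List.length_singleton, pow_succ]
    omega

theorem exists_binaryValue_eq (n r : ℕ) (h : r < 2 ^ n) :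
    ∃ w : List Bool, w.length = n ∧ binaryValue w = r := by
  induction n generalizing r with
  | zero => exact ⟨[], rfl, by simp at h; simp [h, binaryValue]⟩
  | succ n ih =>
    obtain ⟨w, hw, hv⟩ := ih (r / 2) (by rw [pow_succ] at h; omega)
    refine ⟨w ++ [decide (r % 2 = 1)], by simp [hw], ?_⟩
    rw [binaryValue_append, hv]
    rcases Nat.mod_two_eq_zero_or_one r with h2 | h2 <;> simp [h2, binaryValue] <;> omega

theorem binaryValue_injOn {v w : List Bool} (hl : v.length = w.length)
    (h : binaryValue v = binaryValue w) : v = w := by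
  induction v using List.reverseRecOn generalizing w with
  | nil => exact (List.length_eq_zero_iff.1 hl.symm).symm
  | append_singleton v b ih =>
    rcases List.eq_nil_or_concat w with rfl | ⟨w, c, rfl⟩
    · simp at hl
    · rw [List.concat_eq_append] at *
      simp only [List.length_append, List.length_singleton, add_left_inj] at hl
      rw [binaryValue_append, binaryValue_append] at h
      have hb : b = c ∧ binaryValue v = binaryValue w := by
        cases b <;> cases c <;> simp [binaryValue] at h ⊢ <;> omega
      rw [ih hl hb.2, hb.1]

end Words

/-! ### Computable rational-valued functions -/

section ComputableRat

variable {α β : Type*} [Primcodable α] [Primcodable β]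

/-- A rational-valued function computed as a fraction `(u - v) / (w + 1)`. -/
@[fun_prop]
structure RatComputable (q : α → ℚ) : Prop where
  exists_fraction : ∃ u v w : α → ℕ, IsComputable u ∧ IsComputable v ∧ IsComputable w ∧
    ∀ a, q a = ((u a : ℚ) - (v a : ℚ)) / ((w a : ℚ) + 1)

theorem computableRat_iff {q : ℕ → ℕ → ℚ} :
    ComputableRat q ↔ RatComputable fun p : ℕ × ℕ => q p.1 p.2 := by
  constructor
  · rintro ⟨u, v, w, hu, hv, hw, h⟩
    exact ⟨_, _, _, ⟨hu⟩, ⟨hv⟩, ⟨hw⟩, fun a => h a.1 a.2⟩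
  · rintro ⟨u, v, w, hu, hv, hw, h⟩
    exact ⟨fun a b => u (a, b), fun a b => v (a, b), fun a b => w (a, b), hu.1.to₂, hv.1.to₂,
      hw.1.to₂, fun a b => h (a, b)⟩

@[fun_prop]
theorem ratComputable_comp {q : β → ℚ} {f : α → β} (hq : RatComputable q)
    (hf : IsComputable f) : RatComputable fun a => q (f a) := by
  obtain ⟨u, v, w, hu, hv, hw, h⟩ := hq
  exact ⟨_, _, _, computable_comp hu hf, computable_comp hv hf, computable_comp hw hf,
    fun a => h (f a)⟩

@[fun_prop]
theorem ratComputable_natCast {f : α → ℕ} (hf : IsComputable f) :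
    RatComputable fun a => (f a : ℚ) :=
  ⟨f, fun _ => 0, fun _ => 0, hf, computable_const _, computable_const _, fun a => by simp⟩

@[fun_prop]
theorem ratComputable_const (r : ℚ) : RatComputable fun _ : α => r := by
  refine ⟨fun _ => r.num.toNat, fun _ => (-r.num).toNat, fun _ => r.den - 1,
    computable_const _, computable_const _, computable_const _, fun _ => ?_⟩
  have h1 : ((r.num.toNat : ℚ)) - ((-r.num).toNat : ℚ) = r.num := by
    have : ((r.num.toNat : ℤ)) - ((-r.num).toNat : ℤ) = r.num := by omega
    exact_mod_cast this
  have h2 : ((r.den - 1 : ℕ) : ℚ) + 1 = r.den := by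
    have := r.den_pos
    rw [Nat.cast_sub this]; simp
  rw [h1, h2, Rat.num_div_den]

@[fun_prop]
theorem ratComputable_half_pow {f : α → ℕ} (hf : IsComputable f) :
    RatComputable fun a => (1 / 2 : ℚ) ^ f a := by
  refine ⟨fun _ => 1, fun _ => 0, fun a => 2 ^ f a - 1, by fun_prop, by fun_prop, by fun_prop,
    fun a => ?_⟩
  rw [Nat.cast_sub Nat.one_le_two_pow]
  simp

@[fun_prop]
theorem ratComputable_add {q r : α → ℚ} (hq : RatComputable q) (hr : RatComputable r) :
    RatComputable fun a => q a + r a := by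
  obtain ⟨u, v, w, hu, hv, hw, h⟩ := hq
  obtain ⟨u', v', w', hu', hv', hw', h'⟩ := hr
  refine ⟨fun a => u a * (w' a + 1) + u' a * (w a + 1),
    fun a => v a * (w' a + 1) + v' a * (w a + 1), fun a => w a * w' a + w a + w' a,
    by fun_prop, by fun_prop, by fun_prop, fun a => ?_⟩
  have e : ((w a * w' a + w a + w' a : ℕ) : ℚ) + 1 = (w a + 1) * (w' a + 1) := by
    push_cast; ring
  have h1 : (w a : ℚ) + 1 ≠ 0 := by positivity
  have h2 : (w' a : ℚ) + 1 ≠ 0 := by positivity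
  beta_reduce
  rw [e, h, h', div_add_div _ _ h1 h2]
  push_cast
  congr 1
  ring

@[fun_prop]
theorem ratComputable_sub {q r : α → ℚ} (hq : RatComputable q) (hr : RatComputable r) :
    RatComputable fun a => q a - r a := by
  obtain ⟨u, v, w, hu, hv, hw, h⟩ := hr
  have : RatComputable fun a => - r a :=
    ⟨v, u, w, hv, hu, hw, fun a => by rw [h, ← neg_div, neg_sub]⟩
  simpa only [sub_eq_add_neg] using ratComputable_add hq this

@[fun_prop]
theorem ratComputable_mul {q r : α → ℚ} (hq : RatComputable q) (hr : RatComputable r) :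
    RatComputable fun a => q a * r a := by
  obtain ⟨u, v, w, hu, hv, hw, h⟩ := hq
  obtain ⟨u', v', w', hu', hv', hw', h'⟩ := hr
  refine ⟨fun a => u a * u' a + v a * v' a,
    fun a => v a * u' a + u a * v' a, fun a => w a * w' a + w a + w' a,
    by fun_prop, by fun_prop, by fun_prop, fun a => ?_⟩
  have e : ((w a * w' a + w a + w' a : ℕ) : ℚ) + 1 = (w a + 1) * (w' a + 1) := by
    push_cast; ring
  beta_reduce
  rw [e, h, h', div_mul_div_comm]
  push_cast
  congr 1
  ring

@[fun_prop]
theorem computable_decide_rat_le {q r : α → ℚ} (hq : RatComputable q) (hr : RatComputable r) :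
    IsComputable fun a => decide (q a ≤ r a) := by
  obtain ⟨u, v, w, hu, hv, hw, h⟩ := hq
  obtain ⟨u', v', w', hu', hv', hw', h'⟩ := hr
  have : IsComputable fun a => decide (u a * (w' a + 1) + v' a * (w a + 1) ≤
    u' a * (w a + 1) + v a * (w' a + 1)) := by fun_prop
  refine this.of_eq fun a => ?_
  rw [decide_eq_decide, h, h', div_le_div_iff₀ (by positivity) (by positivity), sub_mul, sub_mul,
    sub_le_iff_le_add, sub_add_eq_add_sub, le_sub_iff_add_le]
  norm_cast

@[fun_prop]
theorem computable_decide_rat_lt {q r : α → ℚ} (hq : RatComputable q) (hr : RatComputable r) :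
    IsComputable fun a => decide (q a < r a) :=
  (IsComputable.mk (Primrec.not.to_comp.comp (computable_decide_rat_le hr hq).1)).of_eq fun a => by
    simp [← not_le]

@[fun_prop]
theorem ratComputable_ite {p : α → Prop} [DecidablePred p] {q r : α → ℚ}
    (hp : IsComputable fun a => decide (p a)) (hq : RatComputable q) (hr : RatComputable r) :
    RatComputable fun a => if p a then q a else r a := by
  obtain ⟨u, v, w, hu, hv, hw, h⟩ := hq
  obtain ⟨u', v', w', hu', hv', hw', h'⟩ := hr
  refine ⟨fun a => if p a then u a else u' a, fun a => if p a then v a else v' a,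
    fun a => if p a then w a else w' a, by fun_prop, by fun_prop, by fun_prop, fun a => ?_⟩
  by_cases hpa : p a <;> simp [hpa, h, h']

@[fun_prop]
theorem ratComputable_max {q r : α → ℚ} (hq : RatComputable q) (hr : RatComputable r) :
    RatComputable fun a => max (q a) (r a) := by
  simp only [max_def]
  fun_prop

@[fun_prop]
theorem ratComputable_min {q r : α → ℚ} (hq : RatComputable q) (hr : RatComputable r) :
    RatComputable fun a => min (q a) (r a) := by
  simp only [min_def]
  fun_prop

/-- The recursion is run on triples (u, v, w) representing the current fraction. Hence the step is
only required to preserve computability when a computable rational depending on such a triple is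
substituted for the state. -/
theorem ratComputable_nat_rec {n : α → ℕ} {g : α → ℚ} {h : α → ℕ → ℚ → ℚ} (hn : IsComputable n)
    (hg : RatComputable g)
    (hh : ∀ q : α × ℕ × (ℕ × ℕ × ℕ) → ℚ, RatComputable q →
      RatComputable fun p : α × ℕ × (ℕ × ℕ × ℕ) => h p.1 p.2.1 (q p)) :
    RatComputable fun a => Nat.rec (motive := fun _ => ℚ) (g a) (h a) (n a) := by
  obtain ⟨u, v, w, hu, hv, hw, hq⟩ := hg
  let val : ℕ × ℕ × ℕ → ℚ := fun t => ((t.1 : ℚ) - t.2.1) / (t.2.2 + 1)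
  have hval : RatComputable fun p : α × ℕ × (ℕ × ℕ × ℕ) => val p.2.2 :=
    ⟨fun p => p.2.2.1, fun p => p.2.2.2.1, fun p => p.2.2.2.2, by fun_prop, by fun_prop,
      by fun_prop, fun p => rfl⟩
  obtain ⟨u', v', w', hu', hv', hw', hq'⟩ := hh _ hval
  let step : α → ℕ → ℕ × ℕ × ℕ → ℕ × ℕ × ℕ :=
    fun a j t => (u' (a, j, t), v' (a, j, t), w' (a, j, t))
  have hR : IsComputable fun a =>
      Nat.rec (motive := fun _ => ℕ × ℕ × ℕ) (u a, v a, w a) (step a) (n a) := by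
    apply computable_nat_rec hn (by fun_prop)
    simp only [step]
    fun_prop
  have key : ∀ a k, Nat.rec (motive := fun _ => ℚ) (g a) (h a) k =
      val (Nat.rec (motive := fun _ => ℕ × ℕ × ℕ) (u a, v a, w a) (step a) k) := by
    intro a k
    induction k with
    | zero => exact hq a
    | succ k ih =>
      simp only [ih]
      exact hq' (a, k, _)
  exact ⟨fun a => (Nat.rec (motive := fun _ => ℕ × ℕ × ℕ) (u a, v a, w a) (step a) (n a)).1,
    fun a => (Nat.rec (motive := fun _ => ℕ × ℕ × ℕ) (u a, v a, w a) (step a) (n a)).2.1,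
    fun a => (Nat.rec (motive := fun _ => ℕ × ℕ × ℕ) (u a, v a, w a) (step a) (n a)).2.2,
    computable_fst hR, computable_fst (computable_snd hR), computable_snd (computable_snd hR),
    fun a => key a (n a)⟩

@[fun_prop]
theorem ratComputable_sum {n : α → ℕ} {f : α → ℕ → ℚ} (hn : IsComputable n)
    (hf : RatComputable fun p : α × ℕ => f p.1 p.2) :
    RatComputable fun a => ∑ j ∈ Finset.range (n a), f a j := by
  have h : RatComputable fun a =>
      Nat.rec (motive := fun _ => ℚ) 0 (fun j s => s + f a j) (n a) :=
    ratComputable_nat_rec hn (by fun_prop) fun q hq => by fun_prop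
  convert h using 2 with a
  induction n a with
  | zero => simp
  | succ k ih => rw [Finset.sum_range_succ, ih]

/-- The minimum of `1` and of the values `f 0, …, f (n - 1)`. -/
def minUpTo (f : ℕ → ℚ) (n : ℕ) : ℚ := Nat.rec 1 (fun j s => min s (f j)) n

theorem le_minUpTo_iff {f : ℕ → ℚ} {n : ℕ} {r : ℚ} :
    r ≤ minUpTo f n ↔ r ≤ 1 ∧ ∀ j < n, r ≤ f j := by
  induction n with
  | zero => simp [minUpTo]
  | succ n ih =>
    have : minUpTo f (n + 1) = min (minUpTo f n) (f n) := rfl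
    rw [this, le_min_iff, ih, Nat.forall_lt_succ_right, and_assoc]

theorem minUpTo_eq (f : ℕ → ℚ) (n : ℕ) : minUpTo f n = 1 ∨ ∃ j < n, minUpTo f n = f j := by
  induction n with
  | zero => simp [minUpTo]
  | succ n ih =>
    have : minUpTo f (n + 1) = min (minUpTo f n) (f n) := rfl
    rcases min_choice (minUpTo f n) (f n) with h | h <;> rw [this, h]
    · rcases ih with ih | ⟨j, hj, ih⟩
      · exact .inl ih
      · exact .inr ⟨j, by omega, ih⟩
    · exact .inr ⟨n, by omega, rfl⟩

@[fun_prop]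
theorem ratComputable_minUpTo {n : α → ℕ} {f : α → ℕ → ℚ} (hn : IsComputable n)
    (hf : RatComputable fun p : α × ℕ => f p.1 p.2) :
    RatComputable fun a => minUpTo (f a) (n a) :=
  ratComputable_nat_rec hn (by fun_prop) fun q hq => by fun_prop

end ComputableRat


/-! ### Enumerating machines, complexity and the busy beaver function -/

section Machines

theorem exists_enumeration {D : List Bool →. ℕ} (hD : Partrec D) :
    ∃ f : ℕ → List Bool → Option ℕ, (IsComputable fun x : ℕ × List Bool => f x.1 x.2) ∧
      (∀ j k p y, j ≤ k → f j p = some y → f k p = some y) ∧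
      ∀ p y, y ∈ D p ↔ ∃ k, f k p = some y := by
  obtain ⟨c, hc⟩ := Nat.Partrec.Code.exists_code.1 hD
  refine ⟨fun k p => Nat.Partrec.Code.evaln k c (Encodable.encode p), ?_, ?_, ?_⟩
  · exact ⟨Nat.Partrec.Code.primrec_evaln.to_comp.comp
      (((Computable.fst).pair (Computable.const c)).pair (Computable.encode.comp Computable.snd))⟩
  · intro j k p y hjk h
    exact Nat.Partrec.Code.evaln_mono hjk h
  · intro p y
    have h : D p = c.eval (Encodable.encode p) := by
      rw [hc]; simp [Encodable.encodek, Part.map_id']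
    rw [h, Nat.Partrec.Code.evaln_complete]
    rfl

theorem partrec_search {f : List Bool → ℕ → Option ℕ}
    (hf : IsComputable fun x : List Bool × ℕ => f x.1 x.2) :
    Partrec fun w => Nat.rfindOpt (f w) := Partrec.rfindOpt hf.1.to₂

/-- A search may stop at another hit than the intended one; this is harmless when all hits carry the
same value. -/
theorem mem_search_of_unique {f : ℕ → Option ℕ} {t y : ℕ} (h : f t = some y)
    (hu : ∀ t' y', f t' = some y' → y' = y) : y ∈ Nat.rfindOpt f := by
  have hd : (Nat.rfindOpt f).Dom := Nat.rfindOpt_dom.2 ⟨t, y, h⟩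
  obtain ⟨y', hy'⟩ := Part.dom_iff_mem.1 hd
  obtain ⟨t', ht'⟩ := Nat.rfindOpt_spec hy'
  rwa [← hu t' y' ht']

end Machines

section Complexity

variable {D : List Bool →. ℕ} {x : ℕ}

theorem complexity_le {p : List Bool} (h : x ∈ D p) : complexity D x ≤ p.length :=
  iInf₂_le p h

theorem complexity_le_iff {k : ℕ} :
    complexity D x ≤ k ↔ ∃ p, x ∈ D p ∧ p.length ≤ k := by
  constructor
  · intro h
    by_contra! hc
    have : ((k + 1 : ℕ) : ℕ∞) ≤ complexity D x := le_iInf₂ fun p hp => by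
      exact_mod_cast hc p hp
    have := this.trans h
    norm_cast at this
    omega
  · rintro ⟨p, hp, hk⟩
    exact (complexity_le hp).trans (by exact_mod_cast hk)

theorem exists_of_complexity_le {k : ℕ∞} (hk : k ≠ ⊤) (h : complexity D x ≤ k) :
    ∃ p, x ∈ D p ∧ (p.length : ℕ∞) = complexity D x := by
  obtain ⟨j, hj⟩ := ENat.ne_top_iff_exists.1 (ne_top_of_le_ne_top hk h)
  obtain ⟨p, hp, hl⟩ := complexity_le_iff.1 hj.symm.le
  exact ⟨p, hp, le_antisymm (hj ▸ by exact_mod_cast hl) (complexity_le hp)⟩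

theorem exists_program_of_complexity_eq {k : ℕ} (h : complexity D x = k) :
    ∃ p, x ∈ D p ∧ p.length = k := by
  obtain ⟨p, hp, hl⟩ := exists_of_complexity_le (ENat.natCast_ne_top k) h.le
  exact ⟨p, hp, by exact_mod_cast hl.trans h⟩

theorem finite_outputs (D : List Bool →. ℕ) (t : ℤ) :
    {N : ℕ | ∃ p, N ∈ D p ∧ (p.length : ℤ) ≤ t}.Finite := by
  have h1 : {p : List Bool | p.length ≤ t.toNat}.Finite := List.finite_length_le _ _
  have h2 : ∀ p, {N : ℕ | N ∈ D p}.Finite := fun p =>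
    Set.Subsingleton.finite fun a ha b hb => Part.mem_unique ha hb
  refine (h1.biUnion fun p _ => h2 p).subset ?_
  rintro N ⟨p, hN, hp⟩
  exact Set.mem_biUnion (by simp; omega) hN

theorem busyBeaver_eq (D : List Bool →. ℕ) (t : ℤ) :
    busyBeaver D t = sSup {N : ℕ | ∃ p, N ∈ D p ∧ (p.length : ℤ) ≤ t} := by
  unfold busyBeaver
  congr 1
  ext N
  constructor
  · rintro ⟨k, hk, hkt⟩
    obtain ⟨p, hp, hl⟩ := exists_program_of_complexity_eq hk
    exact ⟨p, hp, hl ▸ hkt⟩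
  · rintro ⟨p, hp, hl⟩
    obtain ⟨q, hq, hql⟩ := exists_of_complexity_le (ENat.natCast_ne_top _) (complexity_le hp)
    refine ⟨q.length, hql.symm, le_trans ?_ hl⟩
    have : (q.length : ℕ∞) ≤ p.length := hql ▸ complexity_le hp
    exact_mod_cast this

theorem le_busyBeaver {p : List Bool} {t : ℤ} (h : x ∈ D p) (hp : (p.length : ℤ) ≤ t) :
    x ≤ busyBeaver D t := by
  rw [busyBeaver_eq]
  exact le_csSup (finite_outputs D t).bddAbove ⟨p, h, hp⟩

theorem busyBeaver_mem_or (D : List Bool →. ℕ) (t : ℤ) :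
    (∃ p, busyBeaver D t ∈ D p ∧ (p.length : ℤ) ≤ t) ∨
      busyBeaver D t = 0 ∧ ∀ p, (D p).Dom → t < p.length := by
  rw [busyBeaver_eq]
  rcases Set.eq_empty_or_nonempty {N : ℕ | ∃ p, N ∈ D p ∧ (p.length : ℤ) ≤ t} with h | h
  · refine .inr ⟨by rw [h]; simp, fun p hp => ?_⟩
    by_contra! hc
    have : (D p).get hp ∈ {N : ℕ | ∃ p, N ∈ D p ∧ (p.length : ℤ) ≤ t} :=
      ⟨p, Part.get_mem hp, hc⟩
    rw [h] at this
    exact this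
  · exact .inl (Nat.sSup_mem h (finite_outputs D t).bddAbove)

theorem busyBeaver_le {t : ℤ} {M : ℕ}
    (h : ∀ N p, N ∈ D p → (p.length : ℤ) ≤ t → N ≤ M) : busyBeaver D t ≤ M := by
  rcases busyBeaver_mem_or D t with ⟨p, hp, hl⟩ | ⟨h0, _⟩
  · exact h _ p hp hl
  · omega

theorem busyBeaver_mono {s t : ℤ} (h : s ≤ t) : busyBeaver D s ≤ busyBeaver D t :=
  busyBeaver_le fun _ _ hN hp => le_busyBeaver hN (hp.trans h)

theorem IsOptimalPlain.exists_const (hD : IsOptimalPlain D) {D' : List Bool →. ℕ}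
    (h : Partrec D') : ∃ c : ℕ, ∀ x p, x ∈ D' p → ∃ q, x ∈ D q ∧ q.length ≤ p.length + c := by
  obtain ⟨c, hc⟩ := hD.2 D' h
  refine ⟨c, fun x p hp => complexity_le_iff.1 ?_⟩
  exact (hc x).trans (by push_cast; gcongr; exact complexity_le hp)

theorem IsOptimalPrefix.exists_const (hD : IsOptimalPrefix D) {D' : List Bool →. ℕ}
    (h : Partrec D') (h' : PrefixFree D') :
    ∃ c : ℕ, ∀ x p, x ∈ D' p → ∃ q, x ∈ D q ∧ q.length ≤ p.length + c := by
  obtain ⟨c, hc⟩ := hD.2.2 D' h h'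
  refine ⟨c, fun x p hp => complexity_le_iff.1 ?_⟩
  exact (hc x).trans (by push_cast; gcongr; exact complexity_le hp)

end Complexity

/-! ### Kraft's inequality -/

section Kraft

/-- With L a common bound on the lengths, p owns the numbers below 2^L whose L-bit expansion begins
with p. If two strings own a common number, one is a prefix of the other, so the owned sets are
disjoint. -/
theorem kraft_of_prefixFree (S : Finset (List Bool))
    (hS : ∀ p ∈ S, ∀ q ∈ S, p <+: q → p = q) :
    ∑ p ∈ S, (1 / 2 : ℚ) ^ p.length ≤ 1 := by
  classical
  obtain ⟨L, hL⟩ : ∃ L, ∀ p ∈ S, p.length ≤ L := ⟨S.sup List.length, fun p hp => Finset.le_sup hp⟩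
  have hdisj : (S : Set (List Bool)).PairwiseDisjoint fun p =>
      Finset.Ico (binaryValue p * 2 ^ (L - p.length))
        ((binaryValue p + 1) * 2 ^ (L - p.length)) := by
    intro p hp q hq hpq
    wlog hlen : p.length ≤ q.length generalizing p q
    · exact (this hq hp hpq.symm (by omega)).symm
    rw [Function.onFun, Finset.disjoint_left]
    intro r hr hr'
    rw [Finset.mem_Ico] at hr hr'
    apply hpq
    refine hS p hp q hq ?_
    have hq' : q = q.take p.length ++ q.drop p.length := (List.take_append_drop _ _).symm
    have hv : binaryValue q = binaryValue (q.take p.length) * 2 ^ (q.length - p.length) +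
        binaryValue (q.drop p.length) := by
      conv_lhs => rw [hq']
      rw [binaryValue_append, List.length_drop]
    have hlt := binaryValue_lt (q.drop p.length)
    rw [List.length_drop] at hlt
    have hLq := hL q hq
    have hpow : 2 ^ (L - p.length) = 2 ^ (q.length - p.length) * 2 ^ (L - q.length) := by
      rw [← pow_add]; congr 1; omega
    have hpos : 0 < 2 ^ (L - q.length) := by positivity
    have hpos' : 0 < 2 ^ (q.length - p.length) := by positivity
    rw [hpow, ← mul_assoc, ← mul_assoc] at hr
    have h1 : binaryValue p * 2 ^ (q.length - p.length) < binaryValue q + 1 :=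
      lt_of_mul_lt_mul_right (hr.1.trans_lt hr'.2) (Nat.zero_le _)
    have h2 : binaryValue q < (binaryValue p + 1) * 2 ^ (q.length - p.length) :=
      lt_of_mul_lt_mul_right (hr'.1.trans_lt hr.2) (Nat.zero_le _)
    have h3 : binaryValue (q.take p.length) = binaryValue p := by
      apply le_antisymm
      · refine Nat.lt_succ_iff.1 (lt_of_mul_lt_mul_right (a := 2 ^ (q.length - p.length)) ?_
          (Nat.zero_le _))
        rw [Nat.succ_eq_add_one]
        omega
      · refine Nat.lt_succ_iff.1 (lt_of_mul_lt_mul_right (a := 2 ^ (q.length - p.length)) ?_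
          (Nat.zero_le _))
        rw [Nat.succ_mul]
        omega
    have h4 : q.take p.length = p :=
      binaryValue_injOn (by rw [List.length_take]; omega) h3
    rw [← h4]
    exact List.take_prefix _ _
  have hsub : S.biUnion (fun p => Finset.Ico (binaryValue p * 2 ^ (L - p.length))
      ((binaryValue p + 1) * 2 ^ (L - p.length))) ⊆ Finset.range (2 ^ L) := by
    intro r hr
    obtain ⟨p, hp, hr⟩ := Finset.mem_biUnion.1 hr
    rw [Finset.mem_Ico] at hr
    refine Finset.mem_range.2 (hr.2.trans_le ?_)
    calc (binaryValue p + 1) * 2 ^ (L - p.length) ≤ 2 ^ p.length * 2 ^ (L - p.length) :=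
          Nat.mul_le_mul_right _ (binaryValue_lt p)
      _ = 2 ^ L := by rw [← pow_add]; congr 1; have := hL p hp; omega
  have hcard := Finset.card_le_card hsub
  rw [Finset.card_biUnion hdisj, Finset.card_range] at hcard
  have hcard' : ∑ p ∈ S, (2 : ℚ) ^ (L - p.length) ≤ 2 ^ L := by
    have : ∑ p ∈ S, 2 ^ (L - p.length) ≤ 2 ^ L := by
      refine le_trans (Finset.sum_le_sum fun p _ => ?_) hcard
      rw [Nat.card_Ico, add_mul, one_mul]; omega
    exact_mod_cast this
  have hterm : ∀ p ∈ S, (1 / 2 : ℚ) ^ p.length = 2 ^ (L - p.length) / 2 ^ L := by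
    intro p hp
    rw [eq_div_iff (by positivity), pow_sub₀ _ two_ne_zero (hL p hp), one_div, inv_pow]
    ring
  rw [Finset.sum_congr rfl hterm, ← Finset.sum_div, div_le_one (by positivity)]
  exact hcard'

end Kraft

/-! ### Tails of the series and maximality of m -/

section TailModulus

variable {m : ℕ → ℝ}

theorem tail_summable (hm : Summable m) (N : ℕ) : Summable fun k => m (N + k) := by
  simpa only [add_comm N] using (summable_nat_add_iff N).2 hm

theorem tail_antitone (h0 : ∀ k, 0 ≤ m k) (hm : Summable m) {M N : ℕ} (h : M ≤ N) :
    ∑' k, m (N + k) ≤ ∑' k, m (M + k) := by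
  obtain ⟨d, rfl⟩ := Nat.exists_eq_add_of_le h
  have := (tail_summable hm M).sum_add_tsum_nat_add d
  have h2 : 0 ≤ ∑ i ∈ Finset.range d, m (M + i) := Finset.sum_nonneg fun _ _ => h0 _
  have h3 : ∑' k, m (M + d + k) = ∑' k, m (M + (k + d)) :=
    tsum_congr fun k => by congr 1; ring
  linarith

theorem tailModulus_le {t : ℤ} {N : ℕ} (h : ∑' k, m (N + 1 + k) < (2 : ℝ) ^ (-t)) :
    tailModulus m t ≤ N := Nat.sInf_le h

theorem tailModulus_nonempty (m : ℕ → ℝ) (t : ℤ) :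
    {N : ℕ | ∑' k : ℕ, m (N + 1 + k) < (2 : ℝ) ^ (-t)}.Nonempty := by
  have h := (tendsto_sum_nat_add m).comp (tendsto_add_atTop_nat 1)
  have hpos : (0 : ℝ) < 2 ^ (-t) := by positivity
  obtain ⟨N, hN⟩ := (h.eventually (gt_mem_nhds hpos)).exists
  refine ⟨N, ?_⟩
  simpa [add_comm] using hN

theorem tail_tailModulus (m : ℕ → ℝ) (t : ℤ) :
    ∑' k, m (tailModulus m t + 1 + k) < (2 : ℝ) ^ (-t) :=
  Nat.sInf_mem (tailModulus_nonempty m t)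

theorem lt_tailModulus (h0 : ∀ k, 0 ≤ m k) (hm : Summable m) {t : ℤ} {N : ℕ}
    (h : (2 : ℝ) ^ (-t) ≤ ∑' k, m (N + 1 + k)) : N < tailModulus m t := by
  by_contra! hc
  have := tail_tailModulus m t
  have h2 := tail_antitone h0 hm (Nat.succ_le_succ hc)
  simp only [Nat.succ_eq_add_one] at h2
  linarith

theorem tailModulus_mono (m : ℕ → ℝ) {s t : ℤ} (h : s ≤ t) :
    tailModulus m s ≤ tailModulus m t :=
  tailModulus_le ((tail_tailModulus m t).trans_le (zpow_le_zpow_right₀ one_le_two (by omega)))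

/-- The dominance of an a priori probability over the limit of an increasing computable family. -/
theorem IsAPriori.exists_dominating (hm : IsAPriori m) {q : ℕ → ℕ → ℚ}
    (hq : RatComputable fun p : ℕ × ℕ => q p.1 p.2) (hmono : ∀ x, Monotone (q x))
    (h0 : ∀ x k, 0 ≤ q x k) (hsum : ∀ N k, ∑ x ∈ Finset.range N, q x k ≤ 1) :
    ∃ C : ℝ, ∀ x k, (q x k : ℝ) ≤ C * m x := by
  have hle1 : ∀ x k, q x k ≤ 1 := fun x k =>
    (Finset.single_le_sum (f := fun x => q x k) (fun x _ => h0 x k)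
      (Finset.self_mem_range_succ x)).trans (hsum (x + 1) k)
  have hmonoR : ∀ x, Monotone fun k => (q x k : ℝ) := fun x i j h => by
    exact Rat.cast_le.2 (hmono x h)
  have hbdd : ∀ x, BddAbove (Set.range fun k => (q x k : ℝ)) := fun x =>
    ⟨1, by rintro _ ⟨k, rfl⟩; exact (Rat.cast_le.2 (hle1 x k)).trans_eq Rat.cast_one⟩
  have hlim : ∀ x, Tendsto (fun k => (q x k : ℝ)) atTop (𝓝 (⨆ k, (q x k : ℝ))) := fun x =>
    tendsto_atTop_ciSup (hmonoR x) (hbdd x)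
  have hpos : ∀ x, 0 ≤ ⨆ k, (q x k : ℝ) := fun x =>
    ge_of_tendsto' (hlim x) fun k => by exact_mod_cast h0 x k
  have hs : Summable fun x => ⨆ k, (q x k : ℝ) := by
    refine summable_of_sum_range_le (c := 1) hpos fun N => ?_
    refine le_of_tendsto' (tendsto_finsetSum (Finset.range N) fun x _ => hlim x) fun k => ?_
    exact_mod_cast hsum N k
  obtain ⟨C, hC⟩ := hm.2 _ hpos hs ⟨q, computableRat_iff.2 hq, hmono, hlim⟩
  exact ⟨C, fun x k => (le_ciSup (hbdd x) k).trans (hC x)⟩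

theorem IsAPriori.exists_pow_dominating (hm : IsAPriori m) {q : ℕ → ℕ → ℚ}
    (hq : RatComputable fun p : ℕ × ℕ => q p.1 p.2) (hmono : ∀ x, Monotone (q x))
    (h0 : ∀ x k, 0 ≤ q x k) (hsum : ∀ N k, ∑ x ∈ Finset.range N, q x k ≤ 1) :
    ∃ c : ℕ, ∀ x k, (q x k : ℝ) ≤ 2 ^ c * m x := by
  obtain ⟨C, hC⟩ := hm.exists_dominating hq hmono h0 hsum
  obtain ⟨c, hc⟩ := pow_unbounded_of_one_lt C (one_lt_two (α := ℝ))
  exact ⟨c, fun x k => (hC x k).trans (mul_le_mul_of_nonneg_right hc.le (hm.1.1 x))⟩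

/-- Maximality is applied to the unit mass at 0. -/
theorem IsAPriori.pos (hm : IsAPriori m) : 0 < ∑' k, m k := by
  obtain ⟨c, hc⟩ := hm.exists_pow_dominating (q := fun x _ => if x < 1 then 1 else 0)
    (by fun_prop) (fun x => monotone_const) (fun x k => by split_ifs <;> simp) fun N k => by
      rw [Finset.sum_ite]
      simp only [Finset.sum_const, smul_zero, add_zero, nsmul_eq_mul, mul_one]
      have : (Finset.filter (fun x => x < 1) (Finset.range N)) ⊆ {0} := fun x hx => by
        simpa using (Finset.mem_filter.1 hx).2
      exact_mod_cast (Finset.card_le_card this).trans (by simp)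
  have := hc 0 0
  simp only [zero_lt_one, if_true, Rat.cast_one] at this
  have h2 : 0 < m 0 := by
    by_contra! h
    have : (2 : ℝ) ^ c * m 0 ≤ 0 := mul_nonpos_of_nonneg_of_nonpos (by positivity) h
    linarith
  exact h2.trans_le (hm.1.2.1.le_tsum 0 fun j _ => hm.1.1 j)

end TailModulus


/-! ### Finite sums over an initial segment of all strings -/

section Words

/-- The binary strings with code less than `k`. -/
noncomputable def words (k : ℕ) : Finset (List Bool) :=
  (Finset.range k).preimage Encodable.encode Encodable.encode_injective.injOn

@[simp]
theorem mem_words {p : List Bool} {k : ℕ} : p ∈ words k ↔ Encodable.encode p < k := by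
  simp [words]

theorem words_mono : Monotone words := fun i j h p hp => by
  rw [mem_words] at *
  omega

@[fun_prop]
theorem ratComputable_sum_words {α : Type*} [Primcodable α] {n : α → ℕ}
    {F : α → List Bool → ℚ} (hn : IsComputable n)
    (hF : RatComputable fun x : α × List Bool => F x.1 x.2) :
    RatComputable fun a => ∑ p ∈ words (n a), F a p := by
  have h : RatComputable fun a => ∑ j ∈ Finset.range (n a),
      if Encodable.encode ((Encodable.decode j : Option (List Bool)).getD []) = j then
        F a ((Encodable.decode j : Option (List Bool)).getD []) else 0 := by fun_prop
  convert h using 2 with a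
  classical
  have := Finset.sum_preimage' (Encodable.encode : List Bool → ℕ) (Finset.range (n a))
    Encodable.encode_injective.injOn
    (fun j => F a ((Encodable.decode j : Option (List Bool)).getD []))
  simp only [Encodable.encodek, Option.getD_some] at this
  rw [words, this, Finset.sum_filter]
  refine Finset.sum_congr rfl fun j _ => ?_
  congr 1
  rw [eq_iff_iff]
  constructor
  · rintro ⟨p, rfl⟩
    simp
  · intro h
    exact ⟨_, h⟩

end Words

variable {D P : List Bool →. ℕ} {m : ℕ → ℝ}

/-! ### Plain descriptions of stages of approximation: BP' against B -/

section Plain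

/-- On input w, wait until the lower approximation of ∑ m passes θ w and print the stage. If θ w is
within 2^(-b) of the sum, the tail from that stage on is below 2^(-b). -/
theorem exists_threshold_const (hD : IsOptimalPlain D) (hm : IsAPriori m) {θ : List Bool → ℚ}
    (hθ : RatComputable θ) :
    ∃ c : ℕ, ∀ (w : List Bool) (b : ℤ), 0 ≤ θ w → (θ w : ℝ) < ∑' k, m k →
      ∑' k, m k ≤ θ w + (2 : ℝ) ^ (-b) → tailModulus m b < busyBeaver D (w.length + c) := by
  obtain ⟨⟨h0, hs, q, hq, hmono, hlim⟩, -⟩ := hm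
  rw [computableRat_iff] at hq
  let A : ℕ → ℚ := fun s => ∑ k ∈ Finset.range s, max (q k s) 0
  have hA : RatComputable A := by fun_prop
  let f : List Bool → ℕ → Option ℕ := fun w s => if θ w < A s then some s else none
  have hf : IsComputable fun x : List Bool × ℕ => f x.1 x.2 := by
    refine computable_ite (computable_decide_rat_lt ?_ ?_) (by fun_prop) (by fun_prop)
    · exact ratComputable_comp hθ (by fun_prop)
    · exact ratComputable_comp hA (by fun_prop)
  obtain ⟨c, hc⟩ := hD.exists_const (partrec_search hf)
  refine ⟨c, fun w b hw0 hw hwb => ?_⟩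
  have hqm : ∀ k s, (q k s : ℝ) ≤ m k := fun k s =>
    Monotone.ge_of_tendsto (f := fun s => (q k s : ℝ))
      (fun i j h => Rat.cast_le.2 (hmono k h)) (hlim k) s
  have hAm : ∀ s, (A s : ℝ) ≤ ∑ k ∈ Finset.range s, m k := by
    intro s
    simp only [A]
    push_cast
    exact Finset.sum_le_sum fun k _ => max_le (hqm k s) (h0 k)
  obtain ⟨K, hK⟩ := (hs.hasSum.tendsto_sum_nat.eventually (lt_mem_nhds hw)).exists
  have hex : ∃ s, θ w < A s := by
    have h1 : Tendsto (fun s => ∑ k ∈ Finset.range K, (q k s : ℝ)) atTop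
        (𝓝 (∑ k ∈ Finset.range K, m k)) := tendsto_finsetSum _ fun k _ => hlim k
    obtain ⟨s, hs1, hs2⟩ := ((h1.eventually (lt_mem_nhds hK)).and (eventually_ge_atTop K)).exists
    refine ⟨s, Rat.cast_lt (K := ℝ).1 (hs1.trans_le ?_)⟩
    simp only [A]
    push_cast
    refine (Finset.sum_le_sum fun k _ => le_max_left _ 0).trans ?_
    exact Finset.sum_le_sum_of_subset_of_nonneg (Finset.range_mono hs2)
      fun k _ _ => le_max_right _ _
  obtain ⟨s₀, hs₀⟩ := hex
  have hdom : (Nat.rfindOpt (f w)).Dom := Nat.rfindOpt_dom.2 ⟨s₀, s₀, by simp [f, hs₀]⟩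
  obtain ⟨s, hs'⟩ := Part.dom_iff_mem.1 hdom
  obtain ⟨s', hfs⟩ := Nat.rfindOpt_spec hs'
  have hlt : θ w < A s := by
    simp only [f, Option.mem_def] at hfs
    split_ifs at hfs with h
    rwa [← Option.some.inj hfs]
  obtain ⟨p, hp, hpl⟩ := hc s w hs'
  have hsB : s ≤ busyBeaver D (w.length + c) := le_busyBeaver hp (by exact_mod_cast hpl)
  -- Stage 0 has sum 0 ≤ θ w, so the printed stage is a successor s + 1; it exceeds the bound s on
  -- the modulus, which makes the inequality strict.
  rcases s with _ | s
  · simp only [A, Finset.range_zero, Finset.sum_empty] at hlt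
    exact absurd hw0 (not_le.2 hlt)
  refine lt_of_lt_of_le (Nat.lt_succ_of_le (tailModulus_le ?_)) hsB
  have h1 := hs.sum_add_tsum_nat_add (s + 1)
  have h2 : ∑' k, m (s + 1 + k) = ∑' k, m (k + (s + 1)) := tsum_congr fun k => by rw [add_comm]
  have h3 : (θ w : ℝ) < A (s + 1) := Rat.cast_lt.2 hlt
  have h4 := hAm (s + 1)
  linarith

/-- The fraction in `[0, 1)` whose binary expansion is the given string. -/
def binaryFraction (w : List Bool) : ℚ := binaryValue w * (1 / 2 : ℚ) ^ w.length

@[fun_prop]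
theorem ratComputable_binaryFraction {α : Type*} [Primcodable α] {f : α → List Bool}
    (hf : IsComputable f) : RatComputable fun a => binaryFraction (f a) := by
  unfold binaryFraction
  fun_prop

theorem binaryFraction_nonneg (w : List Bool) : 0 ≤ binaryFraction w := by
  unfold binaryFraction
  positivity

theorem exists_nat_between {x : ℝ} (hx : 0 < x) {N : ℕ} (hN : x ≤ N) :
    ∃ r < N, (r : ℝ) < x ∧ x ≤ r + 1 := by
  have h1 : 0 < ⌈x⌉₊ := Nat.ceil_pos.2 hx
  have h2 : ⌈x⌉₊ ≤ N := Nat.ceil_le.2 hN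
  refine ⟨⌈x⌉₊ - 1, by omega, Nat.lt_ceil.1 (by omega), ?_⟩
  have := Nat.le_ceil x
  rw [Nat.cast_sub h1]
  simpa using this

theorem exists_tailModulus_le_busyBeaver (hD : IsOptimalPlain D) (hm : IsAPriori m) :
    ∃ d : ℕ, ∀ t : ℤ, tailModulus m t ≤ busyBeaver D (t.toNat + d) := by
  -- As ∑ m < 2^e, a multiple of 2^(-n) just below the sum is written with n + e bits.
  obtain ⟨e, he⟩ := pow_unbounded_of_one_lt (∑' k, m k) (one_lt_two (α := ℝ))
  obtain ⟨c, hc⟩ := exists_threshold_const hD hm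
    (θ := fun w => binaryFraction w * ((2 ^ e : ℕ) : ℚ)) (by fun_prop)
  refine ⟨e + c, fun t => ?_⟩
  set n := t.toNat
  obtain ⟨r, hr, hr1, hr2⟩ := exists_nat_between (x := (∑' k, m k) * 2 ^ n)
    (mul_pos hm.pos (by positivity)) (N := 2 ^ (n + e)) (by
      push_cast
      rw [pow_add, mul_comm]
      gcongr)
  obtain ⟨w, hw, hv⟩ := exists_binaryValue_eq _ r hr
  have hθ : ((binaryFraction w * ((2 ^ e : ℕ) : ℚ) : ℚ) : ℝ) = r / 2 ^ n := by
    rw [binaryFraction, hw, hv]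
    push_cast
    rw [pow_add, one_div, inv_pow, inv_pow]
    field_simp
  have key := hc w n (mul_nonneg (binaryFraction_nonneg w) (by positivity))
    (by rw [hθ, div_lt_iff₀ (by positivity)]; exact hr1)
    (by
      rw [hθ, zpow_neg, zpow_natCast, ← one_div, ← add_div, le_div_iff₀ (by positivity)]
      exact hr2)
  refine (tailModulus_mono m (by omega)).trans (key.le.trans (busyBeaver_mono ?_))
  rw [hw]
  push_cast
  omega

end Plain

/-! ### Prefix-free descriptions: BP against BP', concatenation, Kraft–Chaitin coding -/

section Prefix

/-- Since m dominates the output distribution of P, a number N > 0 with a program of length at most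
t has m(N) ≥ 2^(-t-c), so the tail starting at N is still too large. -/
theorem exists_busyBeaver_le_tailModulus (hP : IsOptimalPrefix P) (hm : IsAPriori m) :
    ∃ c : ℕ, ∀ t : ℤ, busyBeaver P t ≤ tailModulus m (t + c) := by
  obtain ⟨f, hf, hfm, hfP⟩ := exists_enumeration hP.1
  obtain ⟨c, hc⟩ := hm.exists_pow_dominating
    (q := fun x k => ∑ p ∈ words k, if f k p = some x then (1 / 2 : ℚ) ^ p.length else 0)
    (by fun_prop)
    (fun x i j hij => by
      refine (Finset.sum_le_sum fun p _ => ?_).trans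
        (Finset.sum_le_sum_of_subset_of_nonneg (words_mono hij) fun p _ _ => by positivity)
      by_cases h : f i p = some x
      · rw [if_pos h, if_pos (hfm _ _ _ _ hij h)]
      · rw [if_neg h]; positivity)
    (fun x k => Finset.sum_nonneg fun p _ => by positivity)
    (fun N k => by
      rw [Finset.sum_comm]
      refine le_trans ?_ (kraft_of_prefixFree ((words k).filter fun p => (f k p).isSome) ?_)
      · rw [Finset.sum_filter]
        refine Finset.sum_le_sum fun p _ => ?_
        rcases h : f k p with _ | y
        · simp
        · simp [Finset.sum_ite_eq]
          split_ifs <;> simp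
      · intro p hp q hq hpq
        obtain ⟨y, hy⟩ := Option.isSome_iff_exists.1 (Finset.mem_filter.1 hp).2
        obtain ⟨z, hz⟩ := Option.isSome_iff_exists.1 (Finset.mem_filter.1 hq).2
        exact hP.2.1 p q (Part.dom_iff_mem.2 ⟨y, (hfP p y).2 ⟨k, hy⟩⟩)
          (Part.dom_iff_mem.2 ⟨z, (hfP q z).2 ⟨k, hz⟩⟩) hpq)
  refine ⟨c, fun t => busyBeaver_le fun N p hN hp => ?_⟩
  rcases N with _ | N
  · exact Nat.zero_le _
  refine lt_tailModulus hm.1.1 hm.1.2.1 ?_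
  obtain ⟨k, hk⟩ := (hfP p _).1 hN
  have h1 : (1 / 2 : ℝ) ^ p.length ≤ 2 ^ c * m (N + 1) := by
    refine le_trans ?_ (hc (N + 1) (max k (Encodable.encode p + 1)))
    have : (1 / 2 : ℚ) ^ p.length ≤ ∑ p' ∈ words (max k (Encodable.encode p + 1)),
        if f (max k (Encodable.encode p + 1)) p' = some (N + 1) then (1 / 2 : ℚ) ^ p'.length
        else 0 := by
      refine le_trans ?_ (Finset.single_le_sum (fun p' _ => ?_)
        (mem_words.2 (lt_of_lt_of_le (Nat.lt_succ_self _) (le_max_right k _)) : p ∈ _))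
      · rw [if_pos (hfm _ _ _ _ (le_max_left _ _) hk)]
      · positivity
    have := Rat.cast_le (K := ℝ).2 this
    push_cast at this ⊢
    exact this
  have h2 : m (N + 1) ≤ ∑' k, m (N + 1 + k) :=
    (tail_summable hm.1.2.1 (N + 1)).le_tsum 0 fun j _ => hm.1.1 _
  have h3 : (2 : ℝ) ^ (-(t + c)) ≤ (1 / 2 : ℝ) ^ p.length / 2 ^ c := by
    rw [one_div, inv_pow, ← zpow_natCast, ← zpow_neg, ← zpow_natCast, ← zpow_sub₀ two_ne_zero]
    exact zpow_le_zpow_right₀ one_le_two (by omega)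
  refine h3.trans (le_trans ?_ h2)
  rw [div_le_iff₀ (by positivity)]
  linarith

theorem idxOf_true_replicate (n : ℕ) (v : List Bool) :
    (List.replicate n false ++ true :: v).idxOf true = n := by
  induction n with
  | zero => simp
  | succ n ih => simp [List.replicate_succ, ih]

/-- A prefix-free description of `n` turns into a prefix-free description of any number of small
plain complexity, provided that the length of the plain description is determined by it. -/
theorem exists_busyBeaver_le_of_program (hD : IsOptimalPlain D) (hP : IsOptimalPrefix P)
    {g : ℕ → ℕ → ℕ} (hg : IsComputable fun x : ℕ × ℕ => g x.1 x.2) :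
    ∃ c : ℕ, ∀ p n, n ∈ P p → ∀ t : ℤ, t < g n p.length →
      busyBeaver D t ≤ busyBeaver P (p.length + g n p.length + c) := by
  obtain ⟨fD, hfD, hfDm, hfD'⟩ := exists_enumeration hD.1
  obtain ⟨fP, hfP, hfPm, hfP'⟩ := exists_enumeration hP.1
  -- Inputs have the form p 0…0 1 v, where the total length after p is g n p.length. The padding
  -- lets v be any plain program shorter than this; the first 1 marks where v begins.
  let body : List Bool → List Bool → List Bool := fun w p =>
    (w.drop p.length).drop ((w.drop p.length).idxOf true + 1)
  have hbody : IsComputable fun x : List Bool × List Bool => body x.1 x.2 := by fun_prop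
  let F : List Bool → ℕ → Option ℕ := fun w t =>
    if (fP t.unpair.2 (w.take t.unpair.1)).isSome = true ∧
        (w.drop (w.take t.unpair.1).length).length =
          g ((fP t.unpair.2 (w.take t.unpair.1)).getD 0) (w.take t.unpair.1).length then
      fD t.unpair.2 (body w (w.take t.unpair.1)) else none
  have hF : IsComputable fun x : List Bool × ℕ => F x.1 x.2 := by fun_prop
  have hspec : ∀ w t y, F w t = some y → ∃ p n, n ∈ P p ∧ p <+: w ∧
      w.length = p.length + g n p.length ∧ y ∈ D (body w p) := by
    intro w t y h
    simp only [F] at h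
    split_ifs at h with hc
    obtain ⟨n, hn⟩ := Option.isSome_iff_exists.1 hc.1
    have hpre : w.take t.unpair.1 <+: w := List.take_prefix _ _
    refine ⟨_, n, (hfP' _ _).2 ⟨_, hn⟩, hpre, ?_, (hfD' _ _).2 ⟨_, h⟩⟩
    rw [hn, Option.getD_some, List.length_drop] at hc
    have := hpre.length_le
    omega
  have huniq : ∀ w w' t t' y y', F w t = some y → F w' t' = some y' → w <+: w' →
      w = w' ∧ y = y' := by
    intro w w' t t' y y' h h' hww
    obtain ⟨p, n, hn, hp, hl, hy⟩ := hspec w t y h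
    obtain ⟨p', n', hn', hp', hl', hy'⟩ := hspec w' t' y' h'
    have hpp : p = p' := by
      rcases List.prefix_or_prefix_of_prefix (hp.trans hww) hp' with h1 | h1
      · exact hP.2.1 p p' (Part.dom_iff_mem.2 ⟨n, hn⟩) (Part.dom_iff_mem.2 ⟨n', hn'⟩) h1
      · exact (hP.2.1 p' p (Part.dom_iff_mem.2 ⟨n', hn'⟩) (Part.dom_iff_mem.2 ⟨n, hn⟩) h1).symm
    subst hpp
    have hnn := Part.mem_unique hn hn'
    subst hnn
    have hw : w = w' := hww.eq_of_length (by omega)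
    subst hw
    exact ⟨rfl, Part.mem_unique hy hy'⟩
  have hfree : PrefixFree fun w => Nat.rfindOpt (F w) := by
    intro w w' hw hw' hww
    obtain ⟨t, y, h⟩ := Nat.rfindOpt_dom.1 hw
    obtain ⟨t', y', h'⟩ := Nat.rfindOpt_dom.1 hw'
    exact (huniq w w' t t' y y' h h' hww).1
  obtain ⟨c, hc⟩ := hP.exists_const (partrec_search hF) hfree
  refine ⟨c, fun p n hn t ht => busyBeaver_le fun y v hy hv => ?_⟩
  obtain ⟨k₁, hk₁⟩ := (hfP' _ _).1 hn
  obtain ⟨j, hj⟩ : ∃ j, g n p.length = j + 1 + v.length :=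
    ⟨g n p.length - 1 - v.length, by omega⟩
  let r := List.replicate j false ++ true :: v
  have hr : r.length = g n p.length := by simp [r, hj]; omega
  have hb : body (p ++ r) p = v := by
    simp only [body, List.drop_left]
    rw [idxOf_true_replicate, ← List.drop_drop, List.drop_left' (by simp)]
    rfl
  obtain ⟨k₂, hk₂⟩ := (hfD' _ _).1 hy
  obtain ⟨k, hk1, hk2⟩ : ∃ k, fP k p = some n ∧ fD k v = some y :=
    ⟨max k₁ k₂, hfPm _ _ _ _ (le_max_left _ _) hk₁, hfDm _ _ _ _ (le_max_right _ _) hk₂⟩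
  have hmem : F (p ++ r) (Nat.pair p.length k) = some y := by
    simp only [F, Nat.unpair_pair, List.take_left, hk1, hb, hk2, List.drop_left, hr]
    simp
  obtain ⟨q, hq, hql⟩ := hc y (p ++ r)
    (mem_search_of_unique hmem fun t' y' h' => (huniq _ _ _ _ _ _ h' hmem (List.prefix_refl _)).2)
  refine le_busyBeaver hq ?_
  rw [List.length_append, hr] at hql
  exact_mod_cast hql

/-- Prefix-free descriptions of prescribed lengths, one for each request. -/
theorem exists_programs_of_requests (hP : IsOptimalPrefix P) {act : ℕ → Bool} {ℓ out : ℕ → ℕ}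
    (hact : IsComputable act) (hℓ : IsComputable ℓ) (hout : IsComputable out)
    (hsum : ∀ n, ∑ t ∈ Finset.range n, (if act t = true then (1 / 2 : ℚ) ^ ℓ t else 0) ≤ 1) :
    ∃ c : ℕ, ∀ t, act t = true → ∃ q, out t ∈ P q ∧ q.length ≤ ℓ t + c := by
  let S : ℕ → ℚ := fun n => ∑ t ∈ Finset.range n, if act t = true then (1 / 2 : ℚ) ^ ℓ t else 0
  have hS : RatComputable S := by fun_prop
  have hSm : Monotone S := fun i j h =>
    Finset.sum_le_sum_of_subset_of_nonneg (Finset.range_mono h) fun _ _ _ => by positivity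
  -- Request t owns the interval from S t to S (t + 1), of length 2^(-ℓ t) when active. A string of
  -- length ℓ t + 1 serves it if its dyadic interval lies inside; disjointness gives
  -- prefix-freeness.
  let F : List Bool → ℕ → Option ℕ := fun w t =>
    if act t = true ∧ w.length = ℓ t + 1 ∧ S t ≤ binaryFraction w ∧
      binaryFraction w + (1 / 2 : ℚ) ^ w.length ≤ S (t + 1) then some (out t) else none
  have hF : IsComputable fun x : List Bool × ℕ => F x.1 x.2 := by fun_prop
  have huniq : ∀ w w' t t' y y', F w t = some y → F w' t' = some y' → w <+: w' →
      w = w' ∧ y = y' := by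
    intro w w' t t' y y' h h' hww
    simp only [F] at h h'
    split_ifs at h h' with hc hc'
    obtain ⟨u, rfl⟩ := hww
    have e1 : binaryFraction (w ++ u) =
        binaryFraction w + (1 / 2 : ℚ) ^ w.length * binaryFraction u := by
      simp only [binaryFraction, binaryValue_append, List.length_append, pow_add]
      push_cast
      have : (2 : ℚ) ^ u.length * (1 / 2) ^ u.length = 1 := by
        rw [← mul_pow]; norm_num
      linear_combination (binaryValue w : ℚ) * (1 / 2) ^ w.length * this
    have e2 : binaryFraction u < 1 := by
      rw [binaryFraction, one_div, inv_pow, ← div_eq_mul_inv, div_lt_one (by positivity)]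
      exact_mod_cast binaryValue_lt u
    have e3 : binaryFraction (w ++ u) < binaryFraction w + (1 / 2 : ℚ) ^ w.length := by
      rw [e1]
      have : (0 : ℚ) < (1 / 2 : ℚ) ^ w.length := by positivity
      nlinarith
    have e4 : binaryFraction w ≤ binaryFraction (w ++ u) := by
      rw [e1]
      have := binaryFraction_nonneg u
      have : (0 : ℚ) < (1 / 2 : ℚ) ^ w.length := by positivity
      nlinarith
    have e5 : (0 : ℚ) < (1 / 2 : ℚ) ^ (w ++ u).length := by positivity
    have ht : t = t' := by
      rcases lt_trichotomy t t' with h1 | h1 | h1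
      · have := hSm (Nat.succ_le_of_lt h1)
        simp only [Nat.succ_eq_add_one] at this
        linarith [hc.2.2.2, hc'.2.2.1]
      · exact h1
      · have := hSm (Nat.succ_le_of_lt h1)
        simp only [Nat.succ_eq_add_one] at this
        linarith [hc'.2.2.2, hc.2.2.1]
    subst ht
    refine ⟨(List.prefix_append w u).eq_of_length (by omega), ?_⟩
    rw [← Option.some.inj h, ← Option.some.inj h']
  have hfree : PrefixFree fun w => Nat.rfindOpt (F w) := by
    intro w w' hw hw' hww
    obtain ⟨t, y, h⟩ := Nat.rfindOpt_dom.1 hw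
    obtain ⟨t', y', h'⟩ := Nat.rfindOpt_dom.1 hw'
    exact (huniq w w' t t' y y' h h' hww).1
  obtain ⟨c, hc⟩ := hP.exists_const (partrec_search hF) hfree
  refine ⟨1 + c, fun t ht => ?_⟩
  have hSt : S (t + 1) = S t + (1 / 2 : ℚ) ^ ℓ t := by
    simp only [S, Finset.sum_range_succ, ht, if_true]
  have h2 : (1 / 2 : ℚ) ^ ℓ t = 2 * (1 / 2 : ℚ) ^ (ℓ t + 1) := by rw [pow_succ]; ring
  have h3 : (2 : ℚ) ^ (ℓ t + 1) * (1 / 2) ^ (ℓ t + 1) = 1 := by rw [← mul_pow]; norm_num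
  have hpos : (0 : ℚ) < (1 / 2 : ℚ) ^ (ℓ t + 1) := by positivity
  have hS0 : 0 ≤ S t := Finset.sum_nonneg fun _ _ => by positivity
  -- Rounding S t up to the grid of mesh 2^(-ℓ t - 1) loses less than half of the owned interval, so
  -- one grid cell fits. This is the extra bit in the length.
  let k := ⌈S t * 2 ^ (ℓ t + 1)⌉₊
  have hk1 : S t * 2 ^ (ℓ t + 1) ≤ k := Nat.le_ceil _
  have hk2 : (k : ℚ) < S t * 2 ^ (ℓ t + 1) + 1 := Nat.ceil_lt_add_one (by positivity)
  have hlo : S t ≤ k * (1 / 2) ^ (ℓ t + 1) := by nlinarith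
  have hhi : k * (1 / 2) ^ (ℓ t + 1) + (1 / 2) ^ (ℓ t + 1) ≤ S (t + 1) := by
    rw [hSt, h2]
    nlinarith
  have hklt : k < 2 ^ (ℓ t + 1) := by
    have h5 : ((k : ℚ) + 1) * (1 / 2) ^ (ℓ t + 1) ≤ 1 := by linarith [hsum (t + 1)]
    have h6 : (k : ℚ) + 1 ≤ 2 ^ (ℓ t + 1) := by
      have := mul_le_mul_of_nonneg_right h5 (show (0 : ℚ) ≤ 2 ^ (ℓ t + 1) by positivity)
      calc (k : ℚ) + 1 = ((k : ℚ) + 1) * (1 / 2) ^ (ℓ t + 1) * 2 ^ (ℓ t + 1) := by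
            rw [mul_assoc, mul_comm ((1 / 2 : ℚ) ^ (ℓ t + 1)), h3, mul_one]
        _ ≤ _ := by rw [one_mul] at this; exact this
    have : (k : ℚ) < 2 ^ (ℓ t + 1) := by linarith
    exact_mod_cast this
  obtain ⟨w, hw, hv⟩ := exists_binaryValue_eq _ k hklt
  have hmem : F w t = some (out t) := by
    simp only [F]
    rw [if_pos]
    refine ⟨ht, hw, ?_, ?_⟩
    · rw [binaryFraction, hw, hv]; exact hlo
    · rw [binaryFraction, hw, hv]; exact hhi
  obtain ⟨q, hq, hql⟩ := hc (out t) w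
    (mem_search_of_unique hmem fun t' y' h' => (huniq _ _ _ _ _ _ h' hmem (List.prefix_refl _)).2)
  exact ⟨q, hq, by omega⟩

end Prefix


variable {D P : List Bool →. ℕ} {m : ℕ → ℝ}

/-! ### Geometric sums and a counting form of Kraft's inequality -/

section Sums

variable {K : Type*} [Field K] [LinearOrder K] [IsStrictOrderedRing K]

theorem sum_half_pow_ge_le (l B : ℕ) :
    ∑ b ∈ Finset.range B, (if l ≤ b then (1 / 2 : K) ^ b else 0) ≤ 2 * (1 / 2) ^ l := by
  have h : ∑ b ∈ Finset.range B, (if l ≤ b then (1 / 2 : K) ^ b else 0) +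
      2 * (1 / 2) ^ max l B = 2 * (1 / 2) ^ l := by
    induction B with
    | zero => simp
    | succ B ih =>
      rw [Finset.sum_range_succ, ← ih]
      by_cases hl : l ≤ B
      · rw [if_pos hl, max_eq_right hl, max_eq_right (by omega), pow_succ]
        ring
      · rw [if_neg hl, max_eq_left (by omega), max_eq_left (by omega), add_zero]
  have : (0 : K) ≤ 2 * (1 / 2) ^ max l B := by positivity
  linarith

theorem sum_half_pow_le (B : ℕ) : ∑ b ∈ Finset.range B, (1 / 2 : K) ^ b ≤ 2 := by
  simpa using sum_half_pow_ge_le (K := K) 0 B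

theorem sum_two_pow_le {E : Finset ℕ} {X : K} (h0 : 0 ≤ X) (h : ∀ e ∈ E, 2 ^ e ≤ X) :
    ∑ e ∈ E, (2 : K) ^ e ≤ 2 * X := by
  rcases E.eq_empty_or_nonempty with rfl | hE
  · simpa using h0
  · have h1 : ∑ e ∈ E, 2 ^ e < 2 ^ (E.max' hE + 1) :=
      Nat.geomSum_lt le_rfl fun k hk => Nat.lt_succ_of_le (E.le_max' k hk)
    have h2 : ∑ e ∈ E, (2 : K) ^ e ≤ 2 ^ (E.max' hE + 1) := by exact_mod_cast h1.le
    have h3 := h _ (E.max'_mem hE)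
    rw [pow_succ] at h2
    linarith

/-- A consequence of Kraft's inequality: a prefix-free set cannot have `2 ^ e` elements of length
at most `γ e` for all `e < t` unless `∑ 2 ^ (e - γ e)` is bounded. -/
theorem sum_le_of_prefixFree {S : Finset (List Bool)}
    (hS : ∀ p ∈ S, ∀ q ∈ S, p <+: q → p = q) {γ : ℕ → ℕ} {t : ℕ}
    (h : ∀ e < t, (2 : ℚ) ^ e ≤ ((S.filter fun p => p.length ≤ γ e).card : ℚ) + 1) :
    ∑ e ∈ Finset.range t, (2 : ℚ) ^ e * (1 / 2) ^ γ e ≤ 8 := by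
  let B := (Finset.range t).sup γ + 1
  have hB : ∀ e ∈ Finset.range t, γ e ∈ Finset.range B := fun e he =>
    Finset.mem_range.2 (Nat.lt_succ_of_le (Finset.le_sup he))
  -- Group the e sharing one value b: distinct powers of two bounded by X sum to at most 2X.
  have h1 : ∀ b, ∑ e ∈ (Finset.range t).filter (fun e => γ e = b), (2 : ℚ) ^ e * (1 / 2) ^ γ e ≤
      2 * (((S.filter fun p => p.length ≤ b).card : ℚ) + 1) * (1 / 2) ^ b := by
    intro b
    calc _ = (∑ e ∈ (Finset.range t).filter (fun e => γ e = b), (2 : ℚ) ^ e) * (1 / 2) ^ b := by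
          rw [Finset.sum_mul]
          refine Finset.sum_congr rfl fun e he => ?_
          rw [(Finset.mem_filter.1 he).2]
      _ ≤ _ := by
          refine mul_le_mul_of_nonneg_right (sum_two_pow_le (by positivity) fun e he => ?_)
            (by positivity)
          rw [Finset.mem_filter, Finset.mem_range] at he
          rw [← he.2]
          exact h e he.1
  -- Exchange the sums: a program p contributes 2^(-b) for each b ≥ |p|, in all at most 2·2^(-|p|).
  have h2 : ∑ b ∈ Finset.range B,
      ((S.filter fun p => p.length ≤ b).card : ℚ) * (1 / 2) ^ b ≤ 2 := by
    calc _ = ∑ p ∈ S, ∑ b ∈ Finset.range B, (if p.length ≤ b then (1 / 2 : ℚ) ^ b else 0) := by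
          rw [Finset.sum_comm]
          refine Finset.sum_congr rfl fun b _ => ?_
          rw [← Finset.sum_filter, Finset.sum_const, nsmul_eq_mul]
      _ ≤ ∑ p ∈ S, 2 * (1 / 2 : ℚ) ^ p.length :=
          Finset.sum_le_sum fun p _ => sum_half_pow_ge_le _ _
      _ ≤ 2 := by
          rw [← Finset.mul_sum]
          linarith [kraft_of_prefixFree S hS]
  rw [← Finset.sum_fiberwise_of_maps_to hB]
  refine (Finset.sum_le_sum fun b _ => h1 b).trans ?_
  have h3 : ∀ b, 2 * (((S.filter fun p => p.length ≤ b).card : ℚ) + 1) * (1 / 2) ^ b =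
      2 * (((S.filter fun p => p.length ≤ b).card : ℚ) * (1 / 2) ^ b) + 2 * (1 / 2) ^ b :=
    fun b => by ring
  simp only [h3]
  rw [Finset.sum_add_distrib, ← Finset.mul_sum, ← Finset.mul_sum]
  linarith [sum_half_pow_le (K := ℚ) B]

end Sums

/-! ### The two games -/

section Strategies

variable {γ : ℕ → ℕ → ℕ} {t : ℕ → ℕ}

/-- Plain descriptions of the moments when the lower approximation of `∑ m k` passes given
thresholds: these moments are large if the thresholds are dense. -/
theorem false_of_busyBeaver_le (hD : IsOptimalPlain D) (hm : IsAPriori m)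
    (hγ : IsComputable fun x : ℕ × ℕ => γ x.1 x.2)
    (hQ : ∀ i e : ℕ, busyBeaver D ((e + 2 * i + 1 : ℕ) : ℤ) ≤ tailModulus m (γ i e))
    (hsum : ∀ i : ℕ, (i : ℚ) + 8 < ∑ e ∈ Finset.range (t i), (2 : ℚ) ^ e * (1 / 2) ^ γ i e) :
    False := by
  -- `base i L` is the left end of block L. The input 0^i 1 v, with |v| = e, names the left end of
  -- the interval number v in block e.
  let base : ℕ → ℕ → ℚ := fun i L => ∑ e ∈ Finset.range L, ((2 ^ e : ℕ) : ℚ) * (1 / 2) ^ γ i e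
  let body : List Bool → List Bool := fun w => w.drop (w.idxOf true + 1)
  have hbody : IsComputable body := by fun_prop
  let θ : List Bool → ℚ := fun w => base (w.idxOf true) (body w).length +
    (binaryValue (body w) : ℚ) * (1 / 2) ^ γ (w.idxOf true) (body w).length
  have hθ : RatComputable θ := by fun_prop
  have hθ0 : ∀ w, 0 ≤ θ w := fun w => by positivity
  obtain ⟨c, hc⟩ := exists_threshold_const hD hm hθ
  -- One choice of i serves twice: the blocks of game i cover ∑ m, and the description length e + i
  -- + 1 + c is at most e + 2i + 1.
  obtain ⟨i, hiA, hic⟩ : ∃ i : ℕ, ∑' k, m k ≤ i ∧ c ≤ i :=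
    ⟨max ⌈∑' k, m k⌉₊ c, (Nat.le_ceil _).trans (by exact_mod_cast le_max_left _ _),
      le_max_right _ _⟩
  have hbase : ∃ L, ∑' k, m k ≤ ((base i L : ℚ) : ℝ) := by
    refine ⟨t i, hiA.trans ?_⟩
    have h1 : (i : ℚ) ≤ base i (t i) := by
      have := hsum i
      simp only [base]
      push_cast
      linarith
    exact_mod_cast Rat.cast_le (K := ℝ).2 h1
  classical
  obtain ⟨e, he1, he2⟩ : ∃ e, ((base i e : ℚ) : ℝ) < ∑' k, m k ∧
      ∑' k, m k ≤ ((base i (e + 1) : ℚ) : ℝ) := by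
    have hspec := Nat.find_spec hbase
    rcases hL : Nat.find hbase with _ | e
    · rw [hL] at hspec
      have := hm.pos
      simp only [base, Finset.range_zero, Finset.sum_empty, Rat.cast_zero] at hspec
      linarith
    · exact ⟨e, not_le.1 (Nat.find_min hbase (by omega)), hL ▸ hspec⟩
  have hsucc : ((base i (e + 1) : ℚ) : ℝ) = base i e + 2 ^ e / 2 ^ γ i e := by
    simp only [base, Finset.sum_range_succ]
    push_cast
    rw [one_div, inv_pow, div_eq_mul_inv]
  have hg : (0 : ℝ) < 2 ^ γ i e := by positivity
  obtain ⟨r, hr, hr1, hr2⟩ := exists_nat_between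
    (x := (∑' k, m k - ((base i e : ℚ) : ℝ)) * 2 ^ γ i e) (mul_pos (by linarith) hg)
    (N := 2 ^ e) (by
      push_cast
      rw [← le_div_iff₀ hg]
      linarith)
  obtain ⟨v, hv, hvr⟩ := exists_binaryValue_eq e r hr
  let w := List.replicate i false ++ true :: v
  have hw1 : w.idxOf true = i := idxOf_true_replicate i v
  have hw2 : body w = v := by
    simp only [body, hw1, w]
    rw [← List.drop_drop, List.drop_left' (by simp)]
    rfl
  have hθw : ((θ w : ℚ) : ℝ) = base i e + r / 2 ^ γ i e := by
    simp only [θ, hw1, hw2, hv, hvr]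
    push_cast
    rw [one_div, inv_pow, div_eq_mul_inv]
  have key := hc w (γ i e) (hθ0 w)
    (by
      rw [hθw, ← lt_sub_iff_add_lt', div_lt_iff₀ hg]
      exact hr1)
    (by
      rw [hθw, zpow_neg, zpow_natCast, ← one_div, add_assoc, ← add_div, ← sub_le_iff_le_add',
        le_div_iff₀ hg]
      exact hr2)
  have hlen : w.length = i + 1 + e := by simp [w, hv]; omega
  have h3 := (busyBeaver_mono (D := D) (s := w.length + c) (t := ((e + 2 * i + 1 : ℕ) : ℤ))
    (by rw [hlen]; push_cast; omega)).trans (hQ i e)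
  omega

/-- A lower semicomputable series whose tails beat those of the numbers of small prefix
complexity, as long as there are few short prefix-free programs. -/
theorem false_of_tailModulus_le (hP : IsOptimalPrefix P) (hm : IsAPriori m)
    (hγ : IsComputable fun x : ℕ × ℕ => γ x.1 x.2) (ht : IsComputable t)
    (hQ : ∀ i e : ℕ, tailModulus m ((e + 2 * i + 1 : ℕ) : ℤ) ≤ busyBeaver P (γ i e))
    (hsum : ∀ i : ℕ, (i : ℚ) + 8 < ∑ e ∈ Finset.range (t i), (2 : ℚ) ^ e * (1 / 2) ^ γ i e) :
    False := by
  obtain ⟨f, hf, hfm, hfP⟩ := exists_enumeration hP.1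
  -- A program with output y is counted only at stages beyond y + 1, so the one printing the busy
  -- beaver value is still missing at that value plus one.
  let cnt : ℕ → ℕ → ℚ := fun b s => ∑ p ∈ words s,
    if (f s p).isSome = true ∧ (f s p).getD 0 + 1 < s ∧ p.length ≤ b then 1 else 0
  have hcnt : RatComputable fun x : ℕ × ℕ => cnt x.1 x.2 := by fun_prop
  let prog : ℕ → Finset (List Bool) := fun s => (words s).filter fun p =>
    (f s p).isSome = true ∧ (f s p).getD 0 + 1 < s
  have hcntc : ∀ b s, cnt b s = ((prog s).filter fun p => p.length ≤ b).card := by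
    intro b s
    simp only [cnt, prog]
    rw [← Finset.sum_filter, Finset.sum_const, nsmul_eq_mul, mul_one, Finset.filter_filter]
    simp only [and_assoc]
  have hprog : ∀ s p, p ∈ prog s ↔
      Encodable.encode p < s ∧ ∃ y, f s p = some y ∧ y + 1 < s := by
    intro s p
    simp only [prog, Finset.mem_filter, mem_words]
    rcases h : f s p with _ | y <;> simp
  have hprogP : ∀ s p, p ∈ prog s → (P p).Dom := by
    intro s p hp
    obtain ⟨-, y, hy, -⟩ := (hprog s p).1 hp
    exact Part.dom_iff_mem.2 ⟨y, (hfP p y).2 ⟨s, hy⟩⟩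
  have hprogm : Monotone prog := by
    intro s s' hs p hp
    obtain ⟨h1, y, hy, hys⟩ := (hprog s p).1 hp
    exact (hprog s' p).2 ⟨by omega, y, hfm _ _ _ _ hs hy, by omega⟩
  have hcm : ∀ b, Monotone (cnt b) := by
    intro b s s' hs
    rw [hcntc, hcntc]
    exact_mod_cast Finset.card_le_card (Finset.filter_subset_filter _ (hprogm hs))
  have hc0 : ∀ b s, 0 ≤ cnt b s := fun b s => by rw [hcntc]; positivity
  -- A virtual program, missing at stage 1 and present later. It provides the increase when no
  -- program is short enough and the busy beaver value is the default 0.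
  let ind : ℕ → ℚ := fun s => if 2 ≤ s then 1 else 0
  have hind : RatComputable ind := by fun_prop
  have hind0 : ∀ s, 0 ≤ ind s := fun s => by positivity
  have hind1 : ∀ s, ind s ≤ 1 := fun s => by simp only [ind]; split_ifs <;> norm_num
  have hindm : Monotone ind := by
    intro s s' hs
    simp only [ind]
    split_ifs <;> first | omega | norm_num
  let ψ : ℕ → ℕ → ℕ → ℚ := fun i s e => (1 / 2 : ℚ) ^ e * (cnt (γ i e) s + ind s)
  let φ : ℕ → ℕ → ℚ := fun i s => minUpTo (ψ i s) (t i)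
  have hφ : RatComputable fun x : ℕ × ℕ => φ x.1 x.2 := by fun_prop
  have hφ1 : ∀ i s, φ i s ≤ 1 := fun i s => (le_minUpTo_iff.1 le_rfl).1
  have hφψ : ∀ i s, ∀ e < t i, φ i s ≤ ψ i s e := fun i s => (le_minUpTo_iff.1 le_rfl).2
  have hφ0 : ∀ i s, 0 ≤ φ i s := fun i s => le_minUpTo_iff.2 ⟨zero_le_one, fun e _ =>
    mul_nonneg (by positivity) (add_nonneg (hc0 _ _) (hind0 _))⟩
  have hφm : ∀ i, Monotone (φ i) := fun i s s' hs => le_minUpTo_iff.2 ⟨hφ1 i s, fun e he =>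
    (hφψ i s e he).trans (mul_le_mul_of_nonneg_left (add_le_add (hcm _ hs) (hindm hs))
      (by positivity))⟩
  have hterm : ∀ x i, 0 ≤ (1 / 2 : ℚ) ^ (i + 1) * (φ i (x + 1) - φ i x) := fun x i =>
    mul_nonneg (by positivity) (sub_nonneg.2 (hφm i (Nat.le_succ x)))
  -- The point x receives the increments of all φ i from x to x + 1, weighted by 2^(-i-1). Playing
  -- game i = c makes weight and domination constant cost 2c + 1 bits together.
  obtain ⟨c, hc⟩ := hm.exists_pow_dominating
    (q := fun x k => ∑ i ∈ Finset.range k, (1 / 2 : ℚ) ^ (i + 1) * (φ i (x + 1) - φ i x))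
    (by fun_prop)
    (fun x j k hjk => Finset.sum_le_sum_of_subset_of_nonneg (Finset.range_mono hjk)
      fun i _ _ => hterm x i)
    (fun x k => Finset.sum_nonneg fun i _ => hterm x i)
    (fun N k => by
      rw [Finset.sum_comm]
      calc _ ≤ ∑ i ∈ Finset.range k, (1 / 2 : ℚ) ^ (i + 1) := by
            refine Finset.sum_le_sum fun i _ => ?_
            rw [← Finset.mul_sum, Finset.sum_range_sub]
            have h1 := hφ1 i N
            have h2 := hφ0 i 0
            exact mul_le_of_le_one_right (by positivity) (by linarith)
        _ ≤ 1 := by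
            simp only [pow_succ]
            rw [← Finset.sum_mul]
            linarith [sum_half_pow_le (K := ℚ) k])
  have htail : ∀ x₀ N, ((φ c N : ℚ) : ℝ) - (φ c x₀ : ℚ) ≤ 2 ^ (2 * c + 1) * ∑' k, m (x₀ + k) := by
    intro x₀ N
    have hnn : 0 ≤ ∑' k, m (x₀ + k) := tsum_nonneg fun k => hm.1.1 _
    rcases le_total N x₀ with h | h
    · have h1 : ((φ c N : ℚ) : ℝ) ≤ (φ c x₀ : ℚ) := Rat.cast_le.2 (hφm c h)
      have : 0 ≤ 2 ^ (2 * c + 1) * ∑' k, m (x₀ + k) := mul_nonneg (by positivity) hnn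
      linarith
    · obtain ⟨d, rfl⟩ := Nat.exists_eq_add_of_le h
      have h1 : ∀ x, ((φ c (x + 1) : ℚ) : ℝ) - (φ c x : ℚ) ≤ 2 ^ (2 * c + 1) * m x := by
        intro x
        have h2 : (1 / 2 : ℚ) ^ (c + 1) * (φ c (x + 1) - φ c x) ≤
            ∑ i ∈ Finset.range (c + 1), (1 / 2 : ℚ) ^ (i + 1) * (φ i (x + 1) - φ i x) :=
          Finset.single_le_sum (f := fun i => (1 / 2 : ℚ) ^ (i + 1) * (φ i (x + 1) - φ i x))
            (fun i _ => hterm x i) (Finset.self_mem_range_succ c)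
        have h3 := (Rat.cast_le (K := ℝ).2 h2).trans (hc x (c + 1))
        push_cast at h3
        rw [one_div, inv_pow, inv_mul_le_iff₀ (by positivity)] at h3
        calc _ ≤ _ := h3
          _ = _ := by ring
      have h4 := Finset.sum_le_sum fun k (_ : k ∈ Finset.range d) => h1 (x₀ + k)
      have h5 := Finset.sum_range_sub (fun k => ((φ c (x₀ + k) : ℚ) : ℝ)) d
      simp only [← add_assoc, add_zero] at h5
      rw [h5, ← Finset.mul_sum] at h4
      refine h4.trans (mul_le_mul_of_nonneg_left ?_ (by positivity))
      exact (tail_summable hm.1.2.1 x₀).sum_le_tsum _ fun k _ => hm.1.1 _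
  obtain ⟨N, hN2, hN⟩ : ∃ N, 2 ≤ N ∧ ∀ e < t c, ∀ p : List Bool, p.length ≤ γ c e →
      (P p).Dom → p ∈ prog N := by
    have h1 : ∀ e ∈ Finset.range (t c), ∀ᶠ N in atTop,
        ∀ p ∈ {p : List Bool | p.length ≤ γ c e}, (P p).Dom → p ∈ prog N := by
      intro e _
      refine (Filter.eventually_all_finite (List.finite_length_le Bool (γ c e))).2 fun p _ => ?_
      by_cases hp : (P p).Dom
      · obtain ⟨y, hy⟩ := Part.dom_iff_mem.1 hp
        obtain ⟨k, hk⟩ := (hfP p y).1 hy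
        filter_upwards [eventually_ge_atTop (max k (max (Encodable.encode p + 1) (y + 2)))]
          with N hN _
        exact (hprog N p).2 ⟨by omega, y, hfm _ _ _ _ (by omega) hk, by omega⟩
      · exact Eventually.of_forall fun N h => absurd h hp
    obtain ⟨N, h2, h3⟩ := (((Filter.eventually_all_finset (Finset.range (t c))).2 h1).and
      (eventually_ge_atTop 2)).exists
    exact ⟨N, h3, fun e he p hp => h2 e (Finset.mem_range.2 he) p hp⟩
  have hindN : ind N = 1 := if_pos hN2
  -- By stage N every relevant program has been counted. Either the minimum is 1 and Kraft's
  -- inequality is violated, or it is attained at some e, and φ c gains at least 2^(-e) after the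
  -- busy beaver value.
  rcases minUpTo_eq (ψ c N) (t c) with h1 | ⟨e, he, h1⟩
  · have hkraft := sum_le_of_prefixFree (S := prog N) (γ := γ c) (t := t c)
      (fun p hp q hq hpq => hP.2.1 p q (hprogP N p hp) (hprogP N q hq) hpq) (fun e he => by
        have h2 : 1 ≤ ψ c N e := h1.symm.le.trans (hφψ c N e he)
        simp only [ψ, hindN, hcntc] at h2
        rwa [one_div, inv_pow, le_inv_mul_iff₀ (by positivity), mul_one] at h2)
    have := hsum c
    have : (0 : ℚ) ≤ c := by positivity
    linarith
  · set b := γ c e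
    have hy : φ c (busyBeaver P b + 1) ≤ (1 / 2 : ℚ) ^ e * cnt b N := by
      refine (hφψ c _ e he).trans (mul_le_mul_of_nonneg_left ?_ (by positivity))
      rcases busyBeaver_mem_or P b with ⟨p, hp, hpl⟩ | ⟨h0, -⟩
      · have hlt : cnt b (busyBeaver P b + 1) + 1 ≤ cnt b N := by
          rw [hcntc, hcntc]
          have : ((prog (busyBeaver P b + 1)).filter fun p => p.length ≤ b) ⊂
              (prog N).filter fun p => p.length ≤ b := by
            rw [Finset.ssubset_iff_of_subset]
            · refine ⟨p, Finset.mem_filter.2 ⟨hN e he p (by exact_mod_cast hpl)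
                (Part.dom_iff_mem.2 ⟨_, hp⟩), by exact_mod_cast hpl⟩, fun hmem => ?_⟩
              obtain ⟨-, y, hy, hlt⟩ := (hprog _ _).1 (Finset.mem_filter.1 hmem).1
              have := Part.mem_unique hp ((hfP p y).2 ⟨_, hy⟩)
              omega
            · intro p' hp'
              rw [Finset.mem_filter] at hp' ⊢
              exact ⟨hN e he p' hp'.2 (hprogP _ _ hp'.1), hp'.2⟩
          exact_mod_cast Finset.card_lt_card this
        have := hind1 (busyBeaver P b + 1)
        linarith
      · rw [h0]
        have h2 : cnt b (0 + 1) = 0 := by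
          rw [hcntc]
          norm_cast
          rw [Finset.card_eq_zero, Finset.filter_eq_empty_iff]
          intro p hp
          obtain ⟨-, y, -, hlt⟩ := (hprog _ _).1 hp
          omega
        have h3 : ind (0 + 1) = 0 := by simp [ind]
        rw [h2, h3, add_zero]
        exact hc0 b N
    have hφN : φ c N = (1 / 2 : ℚ) ^ e * cnt b N + (1 / 2 : ℚ) ^ e := by
      simp only [φ, h1, ψ, hindN]
      ring
    have h4 : (1 / 2 : ℚ) ^ e ≤ φ c N - φ c (busyBeaver P b + 1) := by linarith
    have h5 := Rat.cast_le (K := ℝ).2 h4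
    push_cast at h5
    have h6 := h5.trans (htail (busyBeaver P b + 1) N)
    refine absurd (lt_tailModulus hm.1.1 hm.1.2.1 (t := ((e + 2 * c + 1 : ℕ) : ℤ)) ?_)
      (not_lt.2 (hQ c e))
    rw [zpow_neg, zpow_natCast, add_assoc, pow_add, mul_inv,
      ← inv_pow 2 e, ← one_div (2 : ℝ), mul_comm, inv_mul_le_iff₀ (by positivity)]
    exact h6

end Strategies


variable {D P : List Bool →. ℕ} {m : ℕ → ℝ} {a : ℕ → ℤ} {X Y : ℤ → ℕ}

/-! ### From growth inequalities to summability -/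

section Limits

/-- Divergence survives the shift of the index by 2i + 1, which leaves room in game i for its label
and for a constant up to i. A search over finite sums and stages then terminates. It may stop before
β has reached its limit, which is why `ForcesSummable` assumes the inequality at every stage. -/
theorem exists_computable_selection {β : ℕ → ℕ → ℕ} {b : ℕ → ℕ}
    (hβ : IsComputable fun x : ℕ × ℕ => β x.1 x.2)
    (hlim : ∀ e, ∀ᶠ k in atTop, β e k = b e)
    (hs : ¬ Summable fun e => (2 : ℝ) ^ e * (1 / 2) ^ b e) :
    ∃ (γ : ℕ → ℕ → ℕ) (t : ℕ → ℕ), (IsComputable fun x : ℕ × ℕ => γ x.1 x.2) ∧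
      IsComputable t ∧ (∀ i e, ∃ k, γ i e = β (e + 2 * i + 1) k) ∧
      ∀ i : ℕ, (i : ℚ) + 8 < ∑ e ∈ Finset.range (t i), (2 : ℚ) ^ e * (1 / 2) ^ γ i e := by
  let p : ℕ → ℕ → Prop := fun i n => (i : ℚ) + ((8 : ℕ) : ℚ) <
    ∑ e ∈ Finset.range n.unpair.1, ((2 ^ e : ℕ) : ℚ) * (1 / 2) ^ β (e + 2 * i + 1) n.unpair.2
  have hp : IsComputable fun x : ℕ × ℕ => decide (p x.1 x.2) :=
    computable_decide_rat_lt (by fun_prop) (by fun_prop)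
  have hex : ∀ i, ∃ n, p i n := by
    intro i
    have h1 : ¬ Summable fun e => (2 : ℝ) ^ e * (1 / 2) ^ b (e + 2 * i + 1) := by
      intro h
      apply hs
      rw [← summable_nat_add_iff (2 * i + 1)]
      refine (h.mul_left (2 ^ (2 * i + 1))).congr fun e => ?_
      rw [pow_add, ← add_assoc]
      ring
    have h2 := (not_summable_iff_tendsto_nat_atTop_of_nonneg
      (fun e => by positivity : ∀ e, 0 ≤ (2 : ℝ) ^ e * (1 / 2) ^ b (e + 2 * i + 1))).1 h1
    obtain ⟨T, hT⟩ := (h2.eventually_gt_atTop ((i : ℝ) + 8)).exists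
    obtain ⟨k, hk⟩ := ((Filter.eventually_all_finset (Finset.range T)).2
      fun e _ => hlim (e + 2 * i + 1)).exists
    refine ⟨Nat.pair T k, ?_⟩
    simp only [p, Nat.unpair_pair]
    rw [Finset.sum_congr rfl fun e he => by rw [hk e he]]
    rw [← Rat.cast_lt (K := ℝ)]
    push_cast
    exact hT
  obtain ⟨F, hF, hFp⟩ := exists_computable_least hp hex
  refine ⟨fun i e => β (e + 2 * i + 1) (F i).unpair.2, fun i => (F i).unpair.1, by fun_prop,
    by fun_prop, fun i e => ⟨_, rfl⟩, fun i => ?_⟩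
  have := (hFp i).1
  simp only [p] at this
  push_cast at this
  exact this

/-- An inequality `X e ≤ Y (b e)` between growth rates forces `∑ 2 ^ (e - b e)` to converge, for
any upper semicomputable sequence `b` of natural numbers. -/
def ForcesSummable (X Y : ℤ → ℕ) : Prop :=
  ∀ (β : ℕ → ℕ → ℕ) (b : ℕ → ℕ), (IsComputable fun x : ℕ × ℕ => β x.1 x.2) →
    (∀ e, ∀ᶠ k in atTop, β e k = b e) → (∀ e > 0, ∀ k, X (e : ℕ) ≤ Y (β e k)) →
    Summable fun e => (2 : ℝ) ^ e * (1 / 2) ^ b e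

theorem forcesSummable_busyBeaver_tailModulus (hD : IsOptimalPlain D) (hm : IsAPriori m) :
    ForcesSummable (busyBeaver D) (tailModulus m) := by
  intro β b hβ hlim hXY
  by_contra hs
  obtain ⟨γ, t, hγ, -, hγβ, hsum⟩ := exists_computable_selection hβ hlim hs
  refine false_of_busyBeaver_le hD hm hγ (fun i e => ?_) hsum
  obtain ⟨k, hk⟩ := hγβ i e
  rw [hk]
  exact hXY _ (Nat.succ_pos _) k

theorem forcesSummable_tailModulus_busyBeaver (hP : IsOptimalPrefix P) (hm : IsAPriori m) :
    ForcesSummable (tailModulus m) (busyBeaver P) := by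
  intro β b hβ hlim hXY
  by_contra hs
  obtain ⟨γ, t, hγ, ht, hγβ, hsum⟩ := exists_computable_selection hβ hlim hs
  refine false_of_tailModulus_le hP hm hγ ht (fun i e => ?_) hsum
  obtain ⟨k, hk⟩ := hγβ i e
  rw [hk]
  exact hXY _ (Nat.succ_pos _) k

/-- Floors of the rational approximations remain above the integer a n and reach it once the
approximation is below a n + 1. -/
theorem UpperSemicomputable.exists_nat_approx (ha : UpperSemicomputable fun n => (a n : ℝ)) :
    ∃ U V : ℕ → ℕ → ℕ, (IsComputable fun x : ℕ × ℕ => U x.1 x.2) ∧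
      (IsComputable fun x : ℕ × ℕ => V x.1 x.2) ∧
      (∀ n k, a n ≤ (U n k : ℤ) - V n k) ∧
      (∀ n j k, j ≤ k → (U n k : ℤ) - V n k ≤ U n j - V n j) ∧
      ∀ n, ∀ᶠ k in atTop, (U n k : ℤ) - V n k = a n := by
  obtain ⟨q, ⟨u, v, w, hu, hv, hw, hq⟩, hanti, hlim⟩ := ha
  have hu' : IsComputable fun x : ℕ × ℕ => u x.1 x.2 := ⟨hu⟩
  have hv' : IsComputable fun x : ℕ × ℕ => v x.1 x.2 := ⟨hv⟩
  have hw' : IsComputable fun x : ℕ × ℕ => w x.1 x.2 := ⟨hw⟩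
  have hfl : ∀ n k, (((u n k + v n k * w n k) / (w n k + 1) : ℕ) : ℤ) - v n k = ⌊q n k⌋ := by
    intro n k
    have h1 : q n k = ((u n k + v n k * w n k : ℕ) : ℚ) / ((w n k + 1 : ℕ) : ℚ) - (v n k : ℕ) := by
      rw [hq]
      push_cast
      field_simp
      ring
    rw [h1, Int.floor_sub_natCast, Rat.floor_natCast_div_natCast]
    norm_cast
  have hge : ∀ n k, ((a n : ℤ) : ℚ) ≤ q n k := by
    intro n k
    have h1 : (a n : ℝ) ≤ (q n k : ℝ) := Antitone.le_of_tendsto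
      (f := fun k => (q n k : ℝ)) (fun i j h => Rat.cast_le.2 (hanti n h)) (hlim n) k
    exact_mod_cast h1
  refine ⟨fun n k => (u n k + v n k * w n k) / (w n k + 1), v, by fun_prop, hv', ?_, ?_, ?_⟩
  · intro n k
    rw [hfl]
    exact Int.le_floor.2 (hge n k)
  · intro n j k hjk
    rw [hfl, hfl]
    exact Int.floor_mono (hanti n hjk)
  · intro n
    filter_upwards [(hlim n).eventually (gt_mem_nhds (lt_add_one (a n : ℝ)))] with k hk
    rw [hfl, Int.floor_eq_iff]
    exact ⟨hge n k, by exact_mod_cast hk⟩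

theorem summable_of_le_shift (hXY : ForcesSummable X Y) (hY : Monotone Y)
    (ha : UpperSemicomputable fun n => (a n : ℝ))
    (h : ∃ c : ℕ, ∀ n : ℕ, X n ≤ Y (n + a n + c)) :
    Summable fun n : ℕ => (2 : ℝ) ^ (-a n) := by
  obtain ⟨c, hc⟩ := h
  obtain ⟨U, V, hU, hV, hge, -, hlim⟩ := ha.exists_nat_approx
  have hs := hXY (fun n k => n + U n k + c - V n k) (fun n => (n + a n + c).toNat) (by fun_prop)
    (fun n => by filter_upwards [hlim n] with k hk; omega)
    (fun n _ k => (hc n).trans (hY (by have := hge n k; omega)))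
  refine Summable.of_norm_bounded_eventually_nat (hs.mul_left (2 ^ c)) ?_
  -- Where `toNat` truncates to 0 the term is 2^n ≥ 1; this happens only finitely often because the
  -- terms tend to 0.
  filter_upwards [hs.tendsto_atTop_zero.eventually (gt_mem_nhds one_pos)] with n hn
  have hpos : 0 < (n + a n + c).toNat := by
    by_contra! h0
    rw [Nat.le_zero.1 h0, pow_zero, mul_one] at hn
    exact absurd hn (not_lt.2 (one_le_pow₀ one_le_two))
  rw [Real.norm_of_nonneg (by positivity), one_div, inv_pow, ← zpow_natCast, ← zpow_natCast,
    ← zpow_natCast, ← zpow_neg, ← zpow_add₀ two_ne_zero, ← zpow_add₀ two_ne_zero]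
  exact (zpow_le_zpow_right₀ one_le_two (by omega))

theorem summable_of_shift_le (hXY : ForcesSummable X Y) (hX : Monotone X)
    (ha : UpperSemicomputable fun n => (a n : ℝ))
    (h : ∃ c : ℕ, ∀ n : ℕ, X (n - a n) ≤ Y (n + c)) :
    Summable fun n : ℕ => (2 : ℝ) ^ (-a n) := by
  obtain ⟨c, hc⟩ := h
  obtain ⟨U, V, hU, hV, hge, hanti, hlim⟩ := ha.exists_nat_approx
  have hgeom : Summable fun n : ℕ => (1 / 2 : ℝ) ^ n := summable_geometric_two
  -- In the bounded case 2^(-a n) ≤ 2^M·2^(-n); otherwise every e is reached by some n - a n and the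
  -- inverse exists.
  by_cases hbd : ∃ M : ℕ, ∀ n : ℕ, n - a n ≤ M
  · obtain ⟨M, hM⟩ := hbd
    refine Summable.of_nonneg_of_le (fun n => by positivity) (fun n => ?_) (hgeom.mul_left (2 ^ M))
    rw [one_div, inv_pow, ← zpow_natCast, ← zpow_natCast, ← zpow_neg, ← zpow_add₀ two_ne_zero]
    exact zpow_le_zpow_right₀ one_le_two (by have := hM n; omega)
  push Not at hbd
  have hex : ∀ e : ℕ, ∃ x : ℕ,
      e + U x.unpair.1 x.unpair.2 ≤ x.unpair.1 + V x.unpair.1 x.unpair.2 := by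
    intro e
    obtain ⟨n, hn⟩ := hbd e
    obtain ⟨k, hk⟩ := (hlim n).exists
    exact ⟨Nat.pair n k, by simp only [Nat.unpair_pair]; omega⟩
  obtain ⟨F, hF, hFp⟩ := exists_computable_least
    (p := fun e x => e + U x.unpair.1 x.unpair.2 ≤ x.unpair.1 + V x.unpair.1 x.unpair.2)
    (by fun_prop) hex
  -- G(e, k) is the least n whose approximation at a late stage shows n - a n ≥ e. Starting from the
  -- stage found by F ensures that some n qualifies for every k. Approximation from above makes each
  -- such n genuine, and the limit in k is the true least one.
  obtain ⟨G, hG, hGp⟩ := exists_computable_least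
    (p := fun (y : ℕ × ℕ) n => y.1 + U n (y.2 + (F y.1).unpair.2) ≤
      n + V n (y.2 + (F y.1).unpair.2)) (by fun_prop) (fun y => by
    have h1 := (hFp y.1).1
    have h2 := hanti (F y.1).unpair.1 _ _ (Nat.le_add_left (F y.1).unpair.2 y.2)
    exact ⟨(F y.1).unpair.1, by omega⟩)
  have hG' : ∀ e k : ℕ, (e : ℤ) ≤ G (e, k) - a (G (e, k)) := fun e k => by
    have h1 := (hGp (e, k)).1
    have h2 := hge (G (e, k)) (k + (F e).unpair.2)
    simp only at h1
    omega
  have hexν : ∀ e : ℕ, ∃ n : ℕ, (e : ℤ) ≤ n - a n := fun e => ⟨_, hG' e 0⟩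
  let ν : ℕ → ℕ := fun e => Nat.find (hexν e)
  have hs := hXY (fun e k => c + G (e, k)) (fun e => c + ν e) (by fun_prop)
    (fun e => by
      filter_upwards [hlim (ν e)] with k hk
      have h1 := hanti (ν e) _ _ (Nat.le_add_right k (F e).unpair.2)
      have h3 : (e : ℤ) ≤ ν e - a (ν e) := Nat.find_spec (hexν e)
      congr 1
      refine le_antisymm ((hGp (e, k)).2 _ ?_) (Nat.find_min' _ (hG' e k))
      simp only
      omega)
    (fun e _ k => (hX (hG' e k)).trans ((hc _).trans_eq (by push_cast; rw [add_comm])))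
  have hs' : Summable fun e => (2 : ℝ) ^ e * (2 * (1 / 2) ^ ν e) := by
    refine (hs.mul_left (2 * 2 ^ c)).congr fun e => ?_
    rw [pow_add, one_div, inv_pow, inv_pow]
    field_simp
  refine summable_of_sum_range_le (c := 2 + ∑' e, (2 : ℝ) ^ e * (2 * (1 / 2) ^ ν e))
    (fun n => by positivity) fun N => ?_
  obtain ⟨M, hM⟩ : ∃ M : ℕ, ∀ n ∈ Finset.range N, ((n : ℤ) - a n).toNat < M :=
    ⟨(Finset.range N).sup (fun n => ((n : ℤ) - a n).toNat) + 1, fun n hn =>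
      Nat.lt_succ_of_le (Finset.le_sup (f := fun n : ℕ => ((n : ℤ) - a n).toNat) hn)⟩
  -- For e = n - a n ≥ 0 the term is 2^e·2^(-n) with ν e ≤ n. Summing 2^(-n) over n ≥ ν e then costs
  -- only a factor 2.
  have hterm : ∀ n ∈ Finset.range N, (2 : ℝ) ^ (-a n) ≤ (1 / 2) ^ n +
      ∑ e ∈ Finset.range M, 2 ^ e * (if ν e ≤ n then (1 / 2) ^ n else 0) := by
    intro n hn
    have hnn : ∀ e ∈ Finset.range M, 0 ≤ (2 : ℝ) ^ e * (if ν e ≤ n then (1 / 2) ^ n else 0) :=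
      fun e _ => by positivity
    have hhalf : (1 / 2 : ℝ) ^ n = 2 ^ (-(n : ℤ)) := by
      rw [one_div, inv_pow, zpow_neg, zpow_natCast]
    rcases le_or_gt 0 ((n : ℤ) - a n) with h0 | h0
    · have hν : ν ((n : ℤ) - a n).toNat ≤ n := Nat.find_min' _ (by omega)
      have h1 := Finset.single_le_sum hnn (Finset.mem_range.2 (hM n hn))
      have h2 : (2 : ℝ) ^ ((n : ℤ) - a n).toNat * (1 / 2) ^ n = 2 ^ (-a n) := by
        rw [hhalf, ← zpow_natCast, ← zpow_add₀ two_ne_zero]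
        congr 1
        omega
      rw [if_pos hν, h2] at h1
      have : (0 : ℝ) ≤ (1 / 2) ^ n := by positivity
      linarith
    · have h1 : (2 : ℝ) ^ (-a n) ≤ (1 / 2) ^ n := by
        rw [hhalf]
        exact zpow_le_zpow_right₀ one_le_two (by omega)
      have := Finset.sum_nonneg hnn
      linarith
  refine (Finset.sum_le_sum hterm).trans ?_
  rw [Finset.sum_add_distrib, Finset.sum_comm]
  refine add_le_add (sum_half_pow_le N) (le_trans (Finset.sum_le_sum fun e _ => ?_)
    (hs'.sum_le_tsum (Finset.range M) fun e _ => by positivity))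
  rw [← Finset.mul_sum]
  exact mul_le_mul_of_nonneg_left (sum_half_pow_ge_le _ _) (by positivity)

end Limits

/-! ### Summability against prefix complexity -/

section Coding

theorem exists_le_of_summable (hP : IsOptimalPrefix P)
    (ha : UpperSemicomputable fun n => (a n : ℝ))
    (hs : Summable fun n : ℕ => (2 : ℝ) ^ (-a n)) :
    ∃ c : ℕ, ∀ n : ℕ, ∃ k : ℕ, complexity P n = k ∧ (k : ℤ) - c ≤ a n := by
  obtain ⟨U, V, hU, hV, hge, hanti, hlim⟩ := ha.exists_nat_approx
  obtain ⟨d, hd⟩ := pow_unbounded_of_one_lt (∑' n : ℕ, (2 : ℝ) ^ (-a n)) (one_lt_two (α := ℝ))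
  have had : ∀ n, 0 ≤ a n + d := by
    intro n
    have h1 := (hs.le_tsum n fun j _ => by positivity).trans_lt hd
    rw [← zpow_natCast] at h1
    have := (zpow_lt_zpow_iff_right₀ (one_lt_two (α := ℝ))).1 h1
    omega
  -- A request for n is issued whenever its approximation drops, and at stage 0 through the summand
  -- 1 - k. The requested lengths strictly decrease, so their total weight is at most twice the last
  -- one; the 1 in d + 1 pays for this.
  let act : ℕ → ℕ → Bool := fun n k =>
    decide (U n k + V n (k - 1) < U n (k - 1) + V n k + (1 - k))
  let ℓ : ℕ → ℕ → ℕ := fun n k => U n k + (d + 1) - V n k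
  have hact : IsComputable fun x : ℕ × ℕ => act x.1 x.2 := by fun_prop
  have hℓ : IsComputable fun x : ℕ × ℕ => ℓ x.1 x.2 := by fun_prop
  have hstep : ∀ n K, ∑ k ∈ Finset.range (K + 1),
      (if act n k = true then (1 / 2 : ℚ) ^ ℓ n k else 0) ≤ 2 * (1 / 2) ^ ℓ n K := by
    intro n K
    induction K with
    | zero =>
      have : (0 : ℚ) < (1 / 2) ^ ℓ n 0 := by positivity
      rw [zero_add, Finset.sum_range_one]
      split_ifs <;> linarith
    | succ K ih =>
      rw [Finset.sum_range_succ]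
      have h1 := hge n (K + 1)
      have h2 := had n
      have h3 := hanti n K (K + 1) (Nat.le_succ K)
      split_ifs with h
      · have h4 : ℓ n (K + 1) + 1 ≤ ℓ n K := by
          simp only [act, decide_eq_true_eq, Nat.add_sub_cancel] at h
          simp only [ℓ]
          omega
        have h5 : (1 / 2 : ℚ) ^ ℓ n K ≤ (1 / 2) ^ (ℓ n (K + 1) + 1) :=
          pow_le_pow_of_le_one (by norm_num) (by norm_num) h4
        rw [pow_succ] at h5
        linarith
      · have h4 : ℓ n (K + 1) ≤ ℓ n K := by
          simp only [ℓ]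
          omega
        have h5 : (1 / 2 : ℚ) ^ ℓ n K ≤ (1 / 2) ^ ℓ n (K + 1) :=
          pow_le_pow_of_le_one (by norm_num) (by norm_num) h4
        linarith
  have hfib : ∀ n K, ∑ k ∈ Finset.range K, (if act n k = true then (1 / 2 : ℚ) ^ ℓ n k else 0) ≤
      2 * (1 / 2) ^ (a n + d + 1).toNat := by
    intro n K
    rcases K with _ | K
    · simp
    · refine (hstep n K).trans (mul_le_mul_of_nonneg_left
        (pow_le_pow_of_le_one (by norm_num) (by norm_num) ?_) zero_le_two)
      have := hge n K
      simp only [ℓ]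
      omega
  have htotal : ∀ N, ∑ n ∈ Finset.range N, 2 * (1 / 2 : ℚ) ^ (a n + d + 1).toNat ≤ 1 := by
    intro N
    rw [← Rat.cast_le (K := ℝ)]
    push_cast
    have h1 : ∀ n : ℕ, 2 * (1 / 2 : ℝ) ^ (a n + d + 1).toNat = 2 ^ (-a n) / 2 ^ d := by
      intro n
      have h2 : (((a n + d + 1).toNat : ℕ) : ℤ) = a n + d + 1 := by have := had n; omega
      rw [one_div, inv_pow, ← zpow_natCast, h2, zpow_add₀ two_ne_zero, zpow_add₀ two_ne_zero,
        zpow_one, zpow_natCast, zpow_neg]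
      field_simp
    simp only [h1]
    rw [← Finset.sum_div, div_le_one (by positivity)]
    exact (hs.sum_le_tsum _ fun n _ => by positivity).trans hd.le
  obtain ⟨c, hc⟩ := exists_programs_of_requests hP (act := fun t => act t.unpair.1 t.unpair.2)
    (ℓ := fun t => ℓ t.unpair.1 t.unpair.2) (out := fun t => t.unpair.1) (by fun_prop)
    (by fun_prop) (by fun_prop) (fun N => by
      let g : ℕ × ℕ → ℚ := fun x => if act x.1 x.2 = true then (1 / 2 : ℚ) ^ ℓ x.1 x.2 else 0
      have hg0 : ∀ x, 0 ≤ g x := fun x => by positivity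
      have hinj : Function.Injective Nat.unpair := Nat.pairEquiv.symm.injective
      calc _ = ∑ x ∈ (Finset.range N).image Nat.unpair, g x := by
            rw [Finset.sum_image fun i _ j _ h => hinj h]
        _ ≤ ∑ x ∈ Finset.range N ×ˢ Finset.range N, g x := by
            refine Finset.sum_le_sum_of_subset_of_nonneg (fun x hx => ?_) fun x _ _ => hg0 x
            obtain ⟨t, ht, rfl⟩ := Finset.mem_image.1 hx
            have h1 := Nat.unpair_left_le t
            have h2 := Nat.unpair_right_le t
            rw [Finset.mem_range] at ht
            simp only [Finset.mem_product, Finset.mem_range]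
            omega
        _ ≤ _ := by
            rw [Finset.sum_product]
            exact (Finset.sum_le_sum fun n _ => hfib n N).trans (htotal N))
  refine ⟨d + 1 + c, fun n => ?_⟩
  classical
  have hex := (hlim n).exists
  have hspec := Nat.find_spec hex
  -- The first stage at which the limit value appears is a strict drop or stage 0, so the shortest
  -- length is requested.
  have hactive : act n (Nat.find hex) = true := by
    simp only [act, decide_eq_true_eq]
    rcases hK : Nat.find hex with _ | K
    · simp
    · have h1 := Nat.find_min hex (m := K) (by omega)
      have h2 := hge n K
      rw [hK] at hspec
      simp only [Nat.add_sub_cancel]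
      omega
  obtain ⟨q, hq, hql⟩ := hc (Nat.pair n (Nat.find hex)) (by simpa using hactive)
  simp only [Nat.unpair_pair] at hq hql
  obtain ⟨r, hr, hrl⟩ := exists_of_complexity_le (ENat.natCast_ne_top _) (complexity_le hq)
  refine ⟨r.length, hrl.symm, ?_⟩
  have h1 : r.length ≤ q.length := by exact_mod_cast hrl.trans_le (complexity_le hq)
  have h2 := had n
  simp only [ℓ] at hql
  omega

theorem summable_of_le (hP : IsOptimalPrefix P)
    (h : ∃ c : ℕ, ∀ n : ℕ, ∃ k : ℕ, complexity P n = k ∧ (k : ℤ) - c ≤ a n) :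
    Summable fun n : ℕ => (2 : ℝ) ^ (-a n) := by
  obtain ⟨c, hc⟩ := h
  choose k hk hka using hc
  choose p hp hpl using fun n => exists_program_of_complexity_eq (hk n)
  have hinj : Function.Injective p := fun i j h => Part.mem_unique (hp i) (h ▸ hp j)
  refine summable_of_sum_range_le (c := 2 ^ c) (fun n => by positivity) fun N => ?_
  have h1 := kraft_of_prefixFree ((Finset.range N).image p) (by
    intro q hq r hr hqr
    obtain ⟨i, -, rfl⟩ := Finset.mem_image.1 hq
    obtain ⟨j, -, rfl⟩ := Finset.mem_image.1 hr
    exact hP.2.1 _ _ (Part.dom_iff_mem.2 ⟨_, hp i⟩) (Part.dom_iff_mem.2 ⟨_, hp j⟩) hqr)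
  rw [Finset.sum_image fun i _ j _ h => hinj h] at h1
  have h2 := Rat.cast_le (K := ℝ).2 h1
  push_cast at h2
  calc _ ≤ ∑ n ∈ Finset.range N, (2 : ℝ) ^ c * (1 / 2) ^ (p n).length := by
        refine Finset.sum_le_sum fun n _ => ?_
        rw [one_div, inv_pow, ← zpow_natCast, ← zpow_natCast, ← zpow_neg,
          ← zpow_add₀ two_ne_zero, hpl]
        exact zpow_le_zpow_right₀ one_le_two (by have := hka n; omega)
    _ ≤ 2 ^ c := by
        rw [← Finset.mul_sum]
        exact mul_le_of_le_one_right (by positivity) h2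

end Coding

/-! ### Growth bounds from prefix complexity -/

section Upper

theorem exists_le_busyBeaver_shift (hD : IsOptimalPlain D) (hP : IsOptimalPrefix P) (d : ℕ)
    (h : ∃ c : ℕ, ∀ n : ℕ, ∃ k : ℕ, complexity P n = k ∧ (k : ℤ) - c ≤ a n) :
    ∃ c : ℕ, ∀ n : ℕ, busyBeaver D (n + d) ≤ busyBeaver P (n + a n + c) := by
  obtain ⟨c, hc⟩ := h
  obtain ⟨c', hc'⟩ := exists_busyBeaver_le_of_program hD hP (g := fun n _ => n + d + 1)
    (by fun_prop)
  refine ⟨c + d + 1 + c', fun n => ?_⟩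
  obtain ⟨k, hk, hka⟩ := hc n
  obtain ⟨p, hp, hpl⟩ := exists_program_of_complexity_eq hk
  exact (hc' p n hp (n + d) (by push_cast; omega)).trans
    (busyBeaver_mono (by push_cast; omega))

/-- The part after a program p for n is given length n + const - |p|, so the whole has length n +
const. As |p| ≤ a n + c, plain programs of length up to n - a n + d fit. The maximum with 0 matches
`toNat` in the bound of BP' by B. -/
theorem exists_busyBeaver_shift_le (hD : IsOptimalPlain D) (hP : IsOptimalPrefix P) (d : ℕ)
    (h : ∃ c : ℕ, ∀ n : ℕ, ∃ k : ℕ, complexity P n = k ∧ (k : ℤ) - c ≤ a n) :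
    ∃ c : ℕ, ∀ n : ℕ, ∀ t : ℤ, t ≤ max (n - a n) 0 + d →
      busyBeaver D t ≤ busyBeaver P (n + c) := by
  obtain ⟨c₀, h₀⟩ := exists_le_busyBeaver_shift hD hP d h
  obtain ⟨c, hc⟩ := h
  obtain ⟨c', hc'⟩ := exists_busyBeaver_le_of_program hD hP (g := fun n l => n + c + d + 1 - l)
    (by fun_prop)
  refine ⟨(a 0 + c₀).toNat + c + d + 1 + c', fun n t ht => ?_⟩
  obtain ⟨k, hk, hka⟩ := hc n
  obtain ⟨p, hp, hpl⟩ := exists_program_of_complexity_eq hk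
  -- For t ≤ d the maximum may come from 0 and p may be too long; one fixed bound, taken at n = 0,
  -- covers all these t.
  rcases le_or_gt t d with htd | htd
  · refine (busyBeaver_mono (by simpa using htd)).trans ((h₀ 0).trans (busyBeaver_mono ?_))
    omega
  · exact (hc' p n hp t (by omega)).trans (busyBeaver_mono (by push_cast; omega))

end Upper

end BusyBeaver

theorem mainTheorem3
    (D : List Bool →. ℕ) (hD : IsOptimalPlain D)
    (P : List Bool →. ℕ) (hP : IsOptimalPrefix P)
    (m : ℕ → ℝ) (hm : IsAPriori m)
    (a : ℕ → ℤ) (ha : UpperSemicomputable (fun n => (a n : ℝ))) :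
    List.TFAE [
      ∃ c : ℕ, ∀ n : ℕ, tailModulus m n ≤ busyBeaver P (n + a n + c),
      ∃ c : ℕ, ∀ n : ℕ, busyBeaver D n ≤ tailModulus m (n + a n + c),
      ∃ c : ℕ, ∀ n : ℕ, busyBeaver D n ≤ busyBeaver P (n + a n + c),
      ∃ c : ℕ, ∀ n : ℕ, tailModulus m (n - a n) ≤ busyBeaver P (n + c),
      ∃ c : ℕ, ∀ n : ℕ, busyBeaver D (n - a n) ≤ tailModulus m (n + c),
      ∃ c : ℕ, ∀ n : ℕ, busyBeaver D (n - a n) ≤ busyBeaver P (n + c),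
      Summable (fun n : ℕ => (2 : ℝ) ^ (-a n)),
      ∃ c : ℕ, ∀ n : ℕ, ∃ k : ℕ, complexity P n = k ∧ (k : ℤ) - c ≤ a n] := by
  obtain ⟨cP, hcP⟩ := exists_busyBeaver_le_tailModulus hP hm
  obtain ⟨d, hd⟩ := exists_tailModulus_le_busyBeaver hD hm
  have monoB : ∀ D : List Bool →. ℕ, Monotone (busyBeaver D) := fun D _ _ h => busyBeaver_mono h
  have monoT : Monotone (tailModulus m) := fun _ _ h => tailModulus_mono m h
  tfae_have 7 → 8 := exists_le_of_summable hP ha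
  tfae_have 8 → 7 := summable_of_le hP
  tfae_have 8 → 3 := fun h => by simpa using exists_le_busyBeaver_shift hD hP 0 h
  tfae_have 8 → 1 := fun h => by
    obtain ⟨c, hc⟩ := exists_le_busyBeaver_shift hD hP d h
    exact ⟨c, fun n => (hd n).trans (hc n)⟩
  tfae_have 8 → 6 := fun h => by
    obtain ⟨c, hc⟩ := exists_busyBeaver_shift_le hD hP 0 h
    exact ⟨c, fun n => hc n _ (by simp)⟩
  tfae_have 8 → 4 := fun h => by
    obtain ⟨c, hc⟩ := exists_busyBeaver_shift_le hD hP d h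
    exact ⟨c, fun n => (hd _).trans (hc n _ (by rw [Int.toNat_eq_max]))⟩
  tfae_have 3 → 2 := fun ⟨c, hc⟩ =>
    ⟨c + cP, fun n => (hc n).trans ((hcP _).trans_eq (by push_cast; rw [add_assoc]))⟩
  tfae_have 6 → 5 := fun ⟨c, hc⟩ =>
    ⟨c + cP, fun n => (hc n).trans ((hcP _).trans_eq (by push_cast; rw [add_assoc]))⟩
  tfae_have 1 → 7 := summable_of_le_shift (forcesSummable_tailModulus_busyBeaver hP hm) (monoB P) ha
  tfae_have 2 → 7 := summable_of_le_shift (forcesSummable_busyBeaver_tailModulus hD hm) monoT ha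
  tfae_have 4 → 7 := summable_of_shift_le (forcesSummable_tailModulus_busyBeaver hP hm) monoT ha
  tfae_have 5 → 7 :=
    summable_of_shift_le (forcesSummable_busyBeaver_tailModulus hD hm) (monoB D) ha
  tfae_finish
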